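/- **System.** Let $p$ source nodes encode their bit streams with polynomial generator rows $G_i(D)\in\mathbb F_2[D]^{1\times s}$ ($i=1,\dots,p$, $s\ge1$) that are linearly independent over $\mathbb F_2[D]$. In each trellis step every source feeds one bit into its feedforward shift register of length $\max_k\deg G_{i,k}$; let $m\ge 1$ be the total number of memory elements. The relay XORs the $p$ codewords and feeds the resulting $s$ bits $\mu_n$ of each step serially into the network encoder (the recursive encoder with state $\sigma^{ne}_{n+1}=\sigma^{ne}_n+\mu_n \bmod 2$) and a binary CPFSK modulator with modulation index $h=K/2$, $K$ odd, rectangular frequency pulse and symbol duration $T$. The complex baseband signal is $$s_b(nT+\tau)=\sqrt{2E_s/T}\,\exp\{j(2\pi h\,\sigma^{ne}_n+2\pi h\,\mu_n\tau/T)\},\qquad 0\le\tau<T,$$ with $E_s=rE_b$, where $E_b>0$ is the energy per information bit and $r=p/s$. It is received in white Gaussian noise of double-sided power spectral density $N_0/2>0$ ($2N_0$ for the complex baseband noise). A block has $N$ steps, i.e. $pN$ independent uniform information bits, and starts in the zero state of the super-trellis (joint convolutional encoder together with network encoder). The destination, without side information, performs maximum-likelihood sequence detection over all source blocks. Let $P_b^d$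 be the bit error probability for an infinitely long block, i.e. the $\limsup$ as $N\to\infty$ of the expected fraction of wrong information bits. **Error events.** The reduced product state of two paths is $(\sigma^{cc},\hat\sigma^{cc},\omega)$, the two states of the joint convolutional encoder together with the difference $\omega$ modulo 2 of the two network-encoder states. An error event is a pair of a transmitted and a competing path of the super-trellis that leave a common state with different inputs and whose reduced product state satisfies $\sigma^{cc}=\hat\sigma^{cc}$, $\omega=0$ again for the first time at the end of the event. Time and length are counted in information bits: the event starts at time $j\in\{0,\dots,p-1\}$ if its first wrong bit is the $j$-th bit of its first step, and its length $\iota$ is $p$ times its number of trellis steps. Its number of symbol errors $\tau$ is the number of wrong information bits, and its normalized squared Euclidean distance (NSED) is $d^2=\frac1{4E_s}\int|s_b-\hat s_b|^2dt$ ($=\frac{1}{2E_s}$ times the squared distance of the passband signals). Let $d_{\min}^2$ be the minimum NSED of all error events. Let $W_{j,\kappa,\iota,\tau,d}$ be the number of error events that start at time $j$ from the joint encoder state $s_\kappa$ (with network-encoder state $0$) and have length $\iota$, $\tau$ symbol errors and NSED $d^2$, and let $$F(\eta,\epsilon,\zeta)=2^{-m}\,\frac1p\sum_{j=0}^{p-1}\sum_{\kappa=1}^{2^m}\sum_{\iota}\sum_{\tau}\sum_{d}W_{j,\kappa,\iota,\tau,d}\,\eta^{\iota}\epsilon^{\tau}\zeta^{d^2}.$$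 **Theorem.** Suppose that the series $F$ converges at $\eta=\tfrac12$, $\epsilon=1$, $\zeta=e^{-E_br/(2N_0)}$ (otherwise the bound is $+\infty$). Then $\epsilon\mapsto F(\tfrac12,\epsilon,e^{-E_br/(2N_0)})$ is differentiable at $\epsilon=1$, and $$P_b^d<Q\!\left(\sqrt{d_{\min}^2\frac{E_br}{N_0}}\right)\exp\!\left(d_{\min}^2\frac{E_br}{2N_0}\right)\left.\frac{\partial F(\eta,\epsilon,\zeta)}{\partial\epsilon}\right|_{\eta=1/2,\ \epsilon=1,\ \zeta=e^{-E_br/(2N_0)}},$$ where $Q(x)=\frac1{\sqrt{2\pi}}\int_x^\infty e^{-z^2/2}\,dz$. -/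

import Mathlib

open MeasureTheory ProbabilityTheory Filter Polynomial

noncomputable section

namespace DistCPFSK

/-! ### The joint distributed convolutional encoder

`p` source nodes, source `i` encoding its bit stream with the polynomial generator row `G i`
(`s` output bits per input bit); the relay adds the `p` codewords over GF(2). -/

/-- One input bit for every source node. -/
abbrev Inp (p : ℕ) := Fin p → ZMod 2

/-- The generator rows of the source encoders. -/
abbrev Gen (p s : ℕ) := Fin p → Fin s → (ZMod 2)[X]

/-- A source block of `N` trellis steps, i.e. `p * N` information bits. -/
abbrev Msg (p N : ℕ) := Fin N → Inp p

variable {p s : ℕ}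

/-- Number of memory elements of the encoder of source `i`. -/
def mem (G : Gen p s) (i : Fin p) : ℕ := Finset.univ.sup fun k => (G i k).natDegree

/-- Total number `m` of memory elements of the joint encoder. -/
def memory (G : Gen p s) : ℕ := ∑ i, mem G i

/-- States of the joint encoder: the contents of the shift registers, most recent bit first.
There are `2 ^ memory G` of them. -/
abbrev JState (G : Gen p s) := (i : Fin p) → Fin (mem G i) → ZMod 2

/-- Shift the input bits into the registers. -/
def nextState (G : Gen p s) (σ : JState G) (x : Inp p) : JState G :=
  fun i d => if d.val = 0 then x i else σ i ⟨d.val - 1, by have := d.isLt; omega⟩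

/-- The `k`-th of the `s` relay code bits in one step: XOR of the source code bits. -/
def outBit (G : Gen p s) (σ : JState G) (x : Inp p) (k : Fin s) : ZMod 2 :=
  ∑ i, ((G i k).coeff 0 * x i + ∑ d : Fin (mem G i), (G i k).coeff (d.val + 1) * σ i d)

/-- State of the joint encoder after `t` steps. -/
def stateAt (G : Gen p s) (σ : JState G) (u : ℕ → Inp p) : ℕ → JState G
  | 0 => σ
  | t + 1 => nextState G (stateAt G σ u t) (u t)

/-- The stream of binary symbols `μ_n` fed into the network encoder, `s` symbols per step. -/
def symbol [NeZero s] (G : Gen p s) (σ : JState G) (u : ℕ → Inp p) (n : ℕ) : ZMod 2 :=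
  outBit G (stateAt G σ u (n / s)) (u (n / s)) (Fin.ofNat s n)

/-- A finite block continued by zeros. -/
def extend {L : ℕ} (u : Msg p L) (t : ℕ) : Inp p := if h : t < L then u ⟨t, h⟩ else 0

/-! ### Network encoder and CPFSK modulator -/

/-- State of the recursive network encoder before symbol `n`: the sum modulo 2 of the previous
symbols. -/
def rscState (μ : ℕ → ZMod 2) : ℕ → ZMod 2
  | 0 => 0
  | n + 1 => rscState μ n + μ n

/-- Phase response on `[0, T]` of the rectangular frequency pulse `1 / (2T)` of length `T`. -/
def phaseResponse (T τ : ℝ) : ℝ := τ / (2 * T)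

/-- Tilted information-carrying phase of binary CPFSK with modulation index `h = K / 2` (phase
modulus 2) at time `t ≥ 0`. The data-independent term vanishes for binary symbols and this pulse. -/
def phase (K : ℕ) (T : ℝ) (μ : ℕ → ZMod 2) (t : ℝ) : ℝ :=
  let n := ⌊t / T⌋₊
  2 * Real.pi * ((K : ℝ) / 2) * ((rscState μ n).val : ℝ) +
    4 * Real.pi * ((K : ℝ) / 2) * ((μ n).val : ℝ) * phaseResponse T (t - n * T)

/-- Unit-amplitude complex envelope. -/
def envelope [NeZero s] (G : Gen p s) (K : ℕ) (T : ℝ) (σ : JState G) (u : ℕ → Inp p) (t : ℝ) : ℂ :=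
  Complex.exp (Complex.I * (phase K T (symbol G σ u) t : ℂ))

/-- Complex baseband signal sent by the relay for the source block `u`, with energy `Es` per CPFSK
symbol; the super-trellis starts in its zero state. -/
def signal [NeZero s] (G : Gen p s) (K : ℕ) (T Es : ℝ) {N : ℕ} (u : Msg p N) : ℝ → ℂ :=
  Set.indicator (Set.Ico 0 (N * s * T)) fun t =>
    (√(2 * Es / T) : ℂ) * envelope G K T 0 (extend u) t

/-! ### AWGN channel and maximum-likelihood sequence detection -/

/-- Real inner product of complex baseband signals. -/
def corr (f g : ℝ → ℂ) : ℝ := ∫ t, ((starRingEnd ℂ) (f t) * g t).re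

/-- `Z f` stands for `Re ∫ conj (n_b t) * f t dt`, where `n_b` is complex baseband white Gaussian
noise of double-sided power spectral density `2 * N0` (passband: `N0 / 2`). -/
structure IsWhiteNoise {Ω : Type*} [MeasurableSpace Ω] (P : Measure Ω) (N0 : ℝ)
    (Z : (ℝ → ℂ) → Ω → ℝ) : Prop where
  gaussian : IsGaussianProcess
    (fun (f : {f : ℝ → ℂ // MemLp f 2 (volume : Measure ℝ)}) => Z f.1) P
  mean : ∀ f : ℝ → ℂ, MemLp f 2 (volume : Measure ℝ) → ∫ ω, Z f ω ∂P = 0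
  covariance : ∀ f g : ℝ → ℂ, MemLp f 2 (volume : Measure ℝ) → MemLp g 2 (volume : Measure ℝ) →
    cov[Z f, Z g; P] = N0 * corr f g

/-- Correlator outputs `v ↦ Re ⟨r_b, s_v⟩` for the received signal `r_b = s_u + n_b`;
they are a sufficient statistic. -/
def received [NeZero s] {Ω : Type*} (G : Gen p s) (K : ℕ) (T Es : ℝ) (Z : (ℝ → ℂ) → Ω → ℝ) {N : ℕ}
    (u : Msg p N) (ω : Ω) : Msg p N → ℝ :=
  fun v => corr (signal G K T Es u) (signal G K T Es v) + Z (signal G K T Es v) ω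

/-- Maximum-likelihood sequence detection over all source blocks of `N` steps: the decision
maximizes the log-likelihood `(Re ⟨r_b, s_v⟩ - ‖s_v‖² / 2) / N0`; ties are broken arbitrarily. -/
structure IsMLSD [NeZero s] (G : Gen p s) (K : ℕ) (T Es : ℝ) {N : ℕ}
    (dec : (Msg p N → ℝ) → Msg p N) : Prop where
  measurable : ∀ v, MeasurableSet (dec ⁻¹' {v})
  maximal : ∀ (y : Msg p N → ℝ) (v : Msg p N),
    y v - corr (signal G K T Es v) (signal G K T Es v) / 2 ≤
      y (dec y) - corr (signal G K T Es (dec y)) (signal G K T Es (dec y)) / 2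

/-- Number of information bits in which two blocks differ. -/
def bitErrors {N : ℕ} (u v : Msg p N) : ℕ :=
  (Finset.univ.filter fun x : Fin N × Fin p => u x.1 x.2 ≠ v x.1 x.2).card

/-- Expected fraction of wrong information bits in a block of `N` steps, all `2 ^ (p * N)` source
blocks being equally likely. -/
def blockBER [NeZero s] {Ω : Type*} [MeasurableSpace Ω] (P : Measure Ω) (G : Gen p s) (K : ℕ)
    (T Es : ℝ) (Z : (ℝ → ℂ) → Ω → ℝ) {N : ℕ} (dec : (Msg p N → ℝ) → Msg p N) : ℝ :=
  (2 ^ (p * N) : ℝ)⁻¹ * ∑ u : Msg p N,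
    ∫ ω, (bitErrors u (dec (received G K T Es Z u ω)) : ℝ) / ((p : ℝ) * N) ∂P

/-- Bit error probability of the relay-to-destination link for an infinitely long block. -/
def bitErrorProb [NeZero s] {Ω : Type*} [MeasurableSpace Ω] (P : Measure Ω) (G : Gen p s) (K : ℕ)
    (T Es : ℝ) (Z : (ℝ → ℂ) → Ω → ℝ) (dec : (N : ℕ) → (Msg p N → ℝ) → Msg p N) : ℝ :=
  limsup (fun N => blockBER P G K T Es Z (dec N)) atTop

/-! ### Error events in the reduced product-state diagram -/

/-- Reduced product state after `t` steps of two paths leaving the same super-trellis state: the two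
joint-encoder states and the difference phase state. -/
def productState [NeZero s] (G : Gen p s) (σ : JState G) (u v : ℕ → Inp p) (t : ℕ) :
    JState G × JState G × ZMod 2 :=
  (stateAt G σ u t, stateAt G σ v t,
    rscState (symbol G σ u) (t * s) - rscState (symbol G σ v) (t * s))

/-- The product states in which error events start and end. -/
def IsMerged {G : Gen p s} (x : JState G × JState G × ZMod 2) : Prop :=
  x.1 = x.2.1 ∧ x.2.2 = 0

/-- An error event: a transmitted and a competing path that leave a common state with different
inputs and whose product state is merged again for the first time after `len` trellis steps. -/
structure ErrorEvent [NeZero s] (G : Gen p s) where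
  start : JState G
  len : ℕ
  sent : Msg p len
  decoded : Msg p len
  len_pos : 0 < len
  diverge : extend sent 0 ≠ extend decoded 0
  unmerged : ∀ t, 0 < t → t < len → ¬ IsMerged (productState G start (extend sent) (extend decoded) t)
  merge : IsMerged (productState G start (extend sent) (extend decoded) len)

/-- The event starts at (bit) time `j` of its first step: the first wrong bit is that of source
`j`. -/
def ErrorEvent.StartsAt [NeZero s] {G : Gen p s} (e : ErrorEvent G) (j : Fin p) : Prop :=
  (∀ k < j, extend e.sent 0 k = extend e.decoded 0 k) ∧ extend e.sent 0 j ≠ extend e.decoded 0 j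

/-- Normalized squared Euclidean distance: the squared distance of the two transmitted signals
divided by twice the energy per CPFSK symbol. -/
def ErrorEvent.nsed [NeZero s] {G : Gen p s} (e : ErrorEvent G) (K : ℕ) (T : ℝ) : ℝ :=
  1 / (2 * T) * ∫ t in (0 : ℝ)..(e.len * s * T),
    ‖envelope G K T e.start (extend e.sent) t - envelope G K T e.start (extend e.decoded) t‖ ^ 2

/-- Minimum normalized squared Euclidean distance. -/
def dminSq [NeZero s] (G : Gen p s) (K : ℕ) (T : ℝ) : ℝ :=
  sInf (Set.range fun e : ErrorEvent G => e.nsed K T)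

/-- Number of error events starting at time `j` from state `σ` that have length `ι`, `τ` bit errors
and NSED `D`. Lengths are counted in information bits, `p` for each trellis step. -/
def eventCount [NeZero s] (G : Gen p s) (K : ℕ) (T : ℝ) (j : Fin p) (σ : JState G) (ι τ : ℕ)
    (D : ℝ) : ℕ :=
  Nat.card {e : ErrorEvent G // e.StartsAt j ∧ e.start = σ ∧ p * e.len = ι ∧
    bitErrors e.sent e.decoded = τ ∧ e.nsed K T = D}

/-- The terms of the transfer function for start time `j` and start state `σ`. -/
def transferTerm [NeZero s] (G : Gen p s) (K : ℕ) (T : ℝ) (j : Fin p) (σ : JState G) (η ε ζ : ℝ)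
    (x : ℕ × ℕ × ℝ) : ℝ :=
  (eventCount G K T j σ x.1 x.2.1 x.2.2 : ℝ) * η ^ x.1 * ε ^ x.2.1 * ζ ^ x.2.2

/-- The average transfer function `F(η, ε, ζ)`. -/
def transferFunction [NeZero s] (G : Gen p s) (K : ℕ) (T : ℝ) (η ε ζ : ℝ) : ℝ :=
  (2 ^ memory G : ℝ)⁻¹ * (1 / (p : ℝ)) *
    ∑ j : Fin p, ∑ σ : JState G, ∑' x : ℕ × ℕ × ℝ, transferTerm G K T j σ η ε ζ x

/-- Gaussian tail function. -/
def gaussQ (x : ℝ) : ℝ := (√(2 * Real.pi))⁻¹ * ∫ z in Set.Ioi x, Real.exp (-z ^ 2 / 2)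

end DistCPFSK

end

noncomputable section

namespace DistCPFSK

/-! The encoders and the reduced product states are linear over `ZMod 2`, so an error event is
governed by its difference word `e`, whose NSED is the integer `e.cost`. Hence
`∂F/∂ε = p⁻¹ ∑' e, e.errors * ζ ^ e.cost`, once `F` is known to converge for some `ε > 1`: its
coefficients come from a finite weighted graph, and for a nonnegative matrix convergence of the sum
over excursions forces the weights of the paths that avoid the zero state to decay geometrically.

The difference of the sent and the decoded stream splits at its visits to the zero state into error
events and at most one unterminated tail. If a segment occurs in the decision, then the sequence
differing from the sent one only in this segment is at least as likely, an event of probability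
`gaussQ √(cost * Es / N0)`. Summing over the segments bounds the expected number of bit errors by
`N * ∑' e, e.errors * gaussQ √(e.cost * Es / N0) + O(1)`, and the claim follows from
`gaussQ √b ≤ gaussQ √a * exp ((a - b) / 2)` for `a ≤ b`, which is strict for `a < b`; an event with
cost greater than `d_min²` exists since there are infinitely many events. -/

/-! ### The Gaussian tail -/

lemma setIntegral_pos_of_forall_pos {α : Type*} [MeasurableSpace α] {μ : Measure α} {s : Set α}
    {f : α → ℝ} (hs : MeasurableSet s) (hμs : μ s ≠ 0) (hf : IntegrableOn f s μ)
    (hpos : ∀ x ∈ s, 0 < f x) : 0 < ∫ x in s, f x ∂μ := by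
  rw [setIntegral_pos_iff_support_of_nonneg_ae
    (ae_restrict_of_forall_mem hs fun x hx => (hpos x hx).le) hf]
  exact hμs.bot_lt.trans_le (measure_mono fun x hx => ⟨(hpos x hx).ne', hx⟩)

lemma integrable_exp_neg_add_sq_div_two (x : ℝ) :
    Integrable fun z : ℝ => Real.exp (-(z + x) ^ 2 / 2) := by
  convert (integrable_exp_neg_mul_sq (b := 1 / 2) (by norm_num)).comp_add_right x using 3
  ring

lemma gaussQ_eq_integral_Ioi_zero (x : ℝ) :
    gaussQ x = (√(2 * Real.pi))⁻¹ * ∫ z in Set.Ioi (0 : ℝ), Real.exp (-(z + x) ^ 2 / 2) := by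
  have hshift := (measurePreserving_add_right (volume : Measure ℝ) x).setIntegral_preimage_emb
    (MeasurableEquiv.addRight x).measurableEmbedding (fun z => Real.exp (-z ^ 2 / 2)) (Set.Ioi x)
  rw [gaussQ, ← hshift]
  simp

lemma gaussQ_pos (x : ℝ) : 0 < gaussQ x :=
  mul_pos (by positivity) <| setIntegral_pos_of_forall_pos measurableSet_Ioi (by simp)
    (by simpa using (integrable_exp_neg_add_sq_div_two 0).integrableOn) fun _ _ => Real.exp_pos _

/-- Both tails are integrals over `0 < z`, where the integrand of `gaussQ b` is that of `gaussQ a`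
times `exp ((a ^ 2 - b ^ 2) / 2) * exp (-(z * (b - a)))`. -/
lemma gaussQ_lt_mul_exp {a b : ℝ} (hab : a < b) :
    gaussQ b < gaussQ a * Real.exp ((a ^ 2 - b ^ 2) / 2) := by
  have hfactor (z : ℝ) : Real.exp (-(z + b) ^ 2 / 2) =
      Real.exp (-(z + a) ^ 2 / 2) * Real.exp ((a ^ 2 - b ^ 2) / 2) *
        Real.exp (-(z * (b - a))) := by
    rw [← Real.exp_add, ← Real.exp_add]
    ring_nf
  have ha := ((integrable_exp_neg_add_sq_div_two a).mul_const
    (Real.exp ((a ^ 2 - b ^ 2) / 2))).integrableOn (s := Set.Ioi 0)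
  have hb := (integrable_exp_neg_add_sq_div_two b).integrableOn (s := Set.Ioi 0)
  rw [gaussQ_eq_integral_Ioi_zero, gaussQ_eq_integral_Ioi_zero, mul_assoc, ← integral_mul_const]
  refine mul_lt_mul_of_pos_left ?_ (by positivity)
  rw [← sub_pos, ← integral_sub ha hb]
  refine setIntegral_pos_of_forall_pos measurableSet_Ioi (by simp) (ha.sub hb) fun z hz => ?_
  rw [hfactor z, ← mul_one_sub]
  refine mul_pos (by positivity) (sub_pos.2 (Real.exp_lt_one_iff.2 ?_))
  exact neg_lt_zero.2 (mul_pos hz (sub_pos.2 hab))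

lemma gaussianReal_zero_one_real_Ici (t : ℝ) : (gaussianReal 0 1).real (Set.Ici t) = gaussQ t := by
  rw [measureReal_def, gaussianReal_apply_eq_integral 0 one_ne_zero, ENNReal.toReal_ofReal
    (integral_nonneg fun x => gaussianPDFReal_nonneg _ _ _), integral_Ici_eq_integral_Ioi, gaussQ,
    ← integral_const_mul]
  simp [gaussianPDFReal_def]

lemma gaussianReal_zero_real_Ici {v : NNReal} (hv : v ≠ 0) (t : ℝ) :
    (gaussianReal 0 v).real (Set.Ici t) = gaussQ (t / √v) := by
  have hsqrt : 0 < √(v : ℝ) := Real.sqrt_pos.2 (by positivity)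
  have hscale : gaussianReal 0 v = (gaussianReal 0 1).map (√(v : ℝ) * ·) := by
    rw [gaussianReal_map_const_mul]
    congr 1
    · simp
    · ext; simp
  have hpre : (√(v : ℝ) * ·) ⁻¹' Set.Ici t = Set.Ici (t / √v) := by
    ext x
    simp [div_le_iff₀' hsqrt]
  rw [hscale, map_measureReal_apply (by fun_prop) measurableSet_Ici, hpre,
    gaussianReal_zero_one_real_Ici]

lemma gaussQ_le_one (t : ℝ) : gaussQ t ≤ 1 := by
  rw [← gaussianReal_zero_one_real_Ici]
  exact measureReal_le_one

lemma gaussQ_sqrt_lt_mul_exp {a b : ℝ} (ha : 0 ≤ a) (hab : a < b) :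
    gaussQ (√b) < gaussQ (√a) * Real.exp (a / 2) * Real.exp (-(b / 2)) := by
  have h := gaussQ_lt_mul_exp (Real.sqrt_lt_sqrt ha hab)
  rwa [Real.sq_sqrt ha, Real.sq_sqrt (ha.trans hab.le), sub_div, sub_eq_add_neg, Real.exp_add,
    ← mul_assoc] at h

lemma gaussQ_sqrt_le_mul_exp {a b : ℝ} (ha : 0 ≤ a) (hab : a ≤ b) :
    gaussQ (√b) ≤ gaussQ (√a) * Real.exp (a / 2) * Real.exp (-(b / 2)) := by
  rcases hab.eq_or_lt with rfl | h
  · rw [mul_assoc, ← Real.exp_add, add_neg_cancel, Real.exp_zero, mul_one]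
  · exact (gaussQ_sqrt_lt_mul_exp ha h).le

lemma gaussQ_sqrt_le_exp {x : ℝ} (hx : 0 ≤ x) : gaussQ (√x) ≤ Real.exp (-(x / 2)) := by
  refine (gaussQ_sqrt_le_mul_exp le_rfl hx).trans ?_
  rw [zero_div, Real.exp_zero, mul_one]
  exact mul_le_of_le_one_left (Real.exp_pos _).le (gaussQ_le_one _)

/-! ### Exponential decay for positive operators in finite dimension -/

section PositiveOperator

open scoped ENNReal

variable {S : Type*}

lemma linearMap_monotone {R E F : Type*} [Semiring R] [AddCommMonoid E] [AddCommMonoid F]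
    [PartialOrder E] [PartialOrder F] [CanonicallyOrderedAdd E] [CanonicallyOrderedAdd F]
    [Module R E] [Module R F] (M : E →ₗ[R] F) : Monotone M := fun f g hfg => by
  obtain ⟨c, rfl⟩ := le_iff_exists_add.1 hfg
  rw [map_add]
  exact le_self_add

/-- The potential `∑' n, M ^ n f` of a function `f` under a positive operator `M`; it takes the
value `∞` where the series diverges. -/
def potential (M : Module.End ℝ≥0∞ (S → ℝ≥0∞)) (f : S → ℝ≥0∞) (x : S) : ℝ≥0∞ :=
  ∑' n, (M ^ n) f x

variable (M : Module.End ℝ≥0∞ (S → ℝ≥0∞))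

lemma potential_mono {f g : S → ℝ≥0∞} (h : f ≤ g) : potential M f ≤ potential M g :=
  fun x => ENNReal.tsum_le_tsum fun n => linearMap_monotone (M ^ n) h x

lemma potential_smul (c : ℝ≥0∞) (f : S → ℝ≥0∞) : potential M (c • f) = c • potential M f := by
  funext x
  simp only [potential, map_smul, Pi.smul_apply, smul_eq_mul, ENNReal.tsum_mul_left]

lemma potential_sum {ι : Type*} (t : Finset ι) (f : ι → S → ℝ≥0∞) :
    potential M (∑ i ∈ t, f i) = ∑ i ∈ t, potential M (f i) := by
  funext x
  simp only [potential, map_sum, Finset.sum_apply]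
  exact Summable.tsum_finsetSum fun _ _ => ENNReal.summable

lemma potential_pow_apply_le (n : ℕ) (f : S → ℝ≥0∞) :
    potential M ((M ^ n) f) ≤ potential M f := fun x => by
  simp only [potential, ← Module.End.mul_apply, ← pow_add]
  exact ENNReal.tsum_comp_le_tsum_of_injective (add_left_injective n) fun k => (M ^ k) f x

lemma tsum_apply_eq_apply_tsum [Finite S] (f : ℕ → S → ℝ≥0∞) (x : S) :
    ∑' n, M (f n) x = M (fun y => ∑' n, f n y) x := by
  classical
  have := Fintype.ofFinite S
  obtain ⟨e, he⟩ : ∃ e : S → ℝ≥0∞, ∀ g, M g x = ∑ y, g y * e y :=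
    ⟨fun y => M (fun z => if y = z then 1 else 0) x, fun g => by
      rw [LinearMap.pi_apply_eq_sum_univ M g]; simp⟩
  simp only [he, ← ENNReal.tsum_mul_right]
  exact Summable.tsum_finsetSum fun _ _ => ENNReal.summable

lemma potential_eq_add [Finite S] (f : S → ℝ≥0∞) :
    potential M f = f + M (potential M f) := by
  funext x
  calc potential M f x = f x + ∑' n, M ((M ^ n) f) x := by
        rw [potential, tsum_eq_zero_add' ENNReal.summable]
        simp only [pow_zero, Module.End.one_apply, pow_succ', Module.End.mul_apply]
    _ = (f + M (potential M f)) x := by rw [tsum_apply_eq_apply_tsum]; rfl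

variable {M} [Finite S]

/-- The constant function is dominated by a combination of the functions `M ^ n b`. -/
lemma potential_one_ne_top {b : S → ℝ≥0∞} (h0 : ∀ x, potential M b x ≠ 0)
    (htop : ∀ x, potential M b x ≠ ∞) (x : S) : potential M 1 x ≠ ∞ := by
  have := Fintype.ofFinite S
  have hne (y : S) : ∃ n, (M ^ n) b y ≠ 0 := by
    by_contra! h
    exact h0 y (ENNReal.tsum_eq_zero.2 h)
  choose n hn using hne
  have hfin (y : S) : (M ^ n y) b y ≠ ∞ := ne_top_of_le_ne_top (htop y) (ENNReal.le_tsum (n y))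
  set c : S → ℝ≥0∞ := fun y => ((M ^ n y) b y)⁻¹
  have hone : (1 : S → ℝ≥0∞) ≤ ∑ y, c y • (M ^ n y) b := fun y => by
    rw [Finset.sum_apply]
    exact (ENNReal.inv_mul_cancel (hn y) (hfin y)).symm.le.trans
      (Finset.single_le_sum (f := fun z => (c z • (M ^ n z) b) y) (fun _ _ => zero_le)
        (Finset.mem_univ y))
  refine ne_top_of_le_ne_top ?_ (potential_mono M hone x)
  rw [potential_sum, Finset.sum_apply, ENNReal.sum_ne_top]
  intro y _
  rw [potential_smul, Pi.smul_apply, smul_eq_mul]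
  exact ENNReal.mul_ne_top (ENNReal.inv_ne_top.2 (hn y))
    (ne_top_of_le_ne_top (htop x) (potential_pow_apply_le M (n y) b x))

/-- A finite potential `h` of `1` is bounded by a constant `H`, so `M h = h - 1 ≤ (1 - 1 / H) h`. -/
lemma exists_pow_apply_one_le (hfin : ∀ x, potential M 1 x ≠ ∞) :
    ∃ ρ C : ℝ≥0∞, ρ < 1 ∧ C ≠ ∞ ∧ ∀ n, (M ^ n) 1 ≤ C • ρ ^ n • (1 : S → ℝ≥0∞) := by
  have := Fintype.ofFinite S
  set h := potential M 1 with hh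
  set H : ℝ≥0∞ := 1 + ∑ x, h x with hH
  have hle (x : S) : h x ≤ H :=
    (Finset.single_le_sum (fun _ _ => zero_le) (Finset.mem_univ x)).trans le_add_self
  have hH0 : H ≠ 0 := by simp [hH]
  have hHtop : H ≠ ∞ :=
    ENNReal.add_ne_top.2 ⟨ENNReal.one_ne_top, ENNReal.sum_ne_top.2 fun x _ => hfin x⟩
  have hcontr : M h ≤ (1 - H⁻¹) • h := fun x => by
    rw [Pi.smul_apply, smul_eq_mul, ENNReal.sub_mul fun _ _ => hfin x, one_mul]
    refine ENNReal.le_sub_of_add_le_right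
      (ENNReal.mul_ne_top (ENNReal.inv_ne_top.2 hH0) (hfin x)) ?_
    calc M h x + H⁻¹ * h x ≤ M h x + H⁻¹ * H := by gcongr; exact hle x
      _ = h x := by
        rw [ENNReal.inv_mul_cancel hH0 hHtop, add_comm]
        exact (congrFun (potential_eq_add M 1) x).symm
  have hiter (n : ℕ) : (M ^ n) h ≤ (1 - H⁻¹) ^ n • h := by
    induction n with
    | zero => simp
    | succ n ih =>
      calc (M ^ (n + 1)) h = (M ^ n) (M h) := by rw [pow_succ, Module.End.mul_apply]
        _ ≤ (1 - H⁻¹) • (M ^ n) h := by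
          rw [← map_smul]; exact linearMap_monotone _ hcontr
        _ ≤ (1 - H⁻¹) ^ (n + 1) • h := by
          rw [pow_succ', mul_smul]
          exact fun x => mul_le_mul_right (ih x) _
  refine ⟨1 - H⁻¹, H, ENNReal.sub_lt_self ENNReal.one_ne_top one_ne_zero
    (ENNReal.inv_ne_zero.2 hHtop), hHtop, fun n x => ?_⟩
  calc (M ^ n) 1 x ≤ (M ^ n) h x := by
        refine linearMap_monotone (M ^ n) ?_ x
        rw [hh, potential_eq_add]
        exact le_self_add
    _ ≤ (1 - H⁻¹) ^ n * h x := hiter n x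
    _ ≤ (1 - H⁻¹) ^ n * H := by gcongr; exact hle x
    _ = (H • (1 - H⁻¹) ^ n • (1 : S → ℝ≥0∞)) x := by
        rw [Pi.smul_apply, Pi.smul_apply, Pi.one_apply, smul_eq_mul, smul_eq_mul, mul_one, mul_comm]

end PositiveOperator

/-! ### Linearity of the encoders -/

section Encoder

variable {p s : ℕ}

lemma nextState_sub (G : Gen p s) (σ σ' : JState G) (x y : Inp p) :
    nextState G (σ - σ') (x - y) = nextState G σ x - nextState G σ' y := by
  funext i d
  simp only [nextState, Pi.sub_apply]
  split_ifs <;> rfl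

lemma outBit_sub (G : Gen p s) (σ σ' : JState G) (x y : Inp p) (k : Fin s) :
    outBit G (σ - σ') (x - y) k = outBit G σ x k - outBit G σ' y k := by
  simp only [outBit, ← Finset.sum_sub_distrib, Pi.sub_apply]
  refine Finset.sum_congr rfl fun i _ => ?_
  simp only [mul_sub, Finset.sum_sub_distrib]
  ring

lemma outBit_zero (G : Gen p s) (k : Fin s) : outBit G 0 0 k = 0 := by
  simpa using outBit_sub G 0 0 0 0 k

lemma stateAt_sub (G : Gen p s) (σ σ' : JState G) (u v : ℕ → Inp p) (t : ℕ) :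
    stateAt G (σ - σ') (u - v) t = stateAt G σ u t - stateAt G σ' v t := by
  induction t with
  | zero => rfl
  | succ t ih => simp only [stateAt, ih, Pi.sub_apply, nextState_sub]

lemma symbol_sub [NeZero s] (G : Gen p s) (σ σ' : JState G) (u v : ℕ → Inp p) :
    symbol G (σ - σ') (u - v) = symbol G σ u - symbol G σ' v := by
  funext n
  simp only [symbol, stateAt_sub, Pi.sub_apply, outBit_sub]

lemma rscState_sub (μ ν : ℕ → ZMod 2) (n : ℕ) :
    rscState (μ - ν) n = rscState μ n - rscState ν n := by
  induction n with
  | zero => simp [rscState]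
  | succ n ih => simp only [rscState, ih, Pi.sub_apply]; ring

lemma rscState_add (μ : ℕ → ZMod 2) (n k : ℕ) :
    rscState μ (n + k) = rscState μ n + rscState (fun i => μ (n + i)) k := by
  induction k with
  | zero => simp [rscState]
  | succ k ih => rw [← add_assoc, rscState, ih, rscState]; ring

lemma rscState_congr {μ ν : ℕ → ZMod 2} {n : ℕ} (h : ∀ i < n, μ i = ν i) :
    rscState μ n = rscState ν n := by
  induction n with
  | zero => rfl
  | succ n ih =>
    simp only [rscState, ih fun i hi => h i (hi.trans n.lt_succ_self), h n n.lt_succ_self]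

lemma extend_sub {L : ℕ} (u v : Msg p L) : extend (u - v) = extend u - extend v := by
  funext t
  simp only [extend, Pi.sub_apply]
  split_ifs <;> simp

lemma extend_of_lt {L : ℕ} (u : Msg p L) {t : ℕ} (h : t < L) : extend u t = u ⟨t, h⟩ := by
  simp [extend, h]

lemma extend_of_le {L : ℕ} (u : Msg p L) {t : ℕ} (h : L ≤ t) : extend u t = 0 := by
  simp [extend, h.not_gt]

/-! ### Injectivity of the joint encoder -/

lemma stateAt_zero_apply (G : Gen p s) (u : ℕ → Inp p) (t : ℕ) (i : Fin p) (d : Fin (mem G i)) :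
    stateAt G 0 u t i d = if d.val < t then u (t - 1 - d.val) i else 0 := by
  induction t generalizing d with
  | zero => simp [stateAt]
  | succ t ih =>
    rw [stateAt, nextState]
    split_ifs with h0 h1 h1
    · simp [h0]
    · omega
    · rw [ih, if_pos (by simp only; omega)]
      rw [show t - 1 - (d.val - 1) = t + 1 - 1 - d.val by omega]
    · rw [ih, if_neg (by simp only; omega)]

lemma coeff_eq_zero_of_mem_lt (G : Gen p s) {i : Fin p} (k : Fin s) {d : ℕ} (hd : mem G i < d) :
    (G i k).coeff d = 0 :=
  coeff_eq_zero_of_natDegree_lt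
    ((Finset.le_sup (f := fun k => (G i k).natDegree) (Finset.mem_univ k)).trans_lt hd)

lemma coeff_mul_generator (G : Gen p s) (i : Fin p) (k : Fin s) {u : ℕ → Inp p} {e : (ZMod 2)[X]}
    (he : ∀ t, e.coeff t = u t i) (t : ℕ) :
    (e * G i k).coeff t = (G i k).coeff 0 * u t i +
      ∑ d : Fin (mem G i), (G i k).coeff (d.val + 1) * stateAt G 0 u t i d := by
  set c : ℕ → ZMod 2 := fun d => (G i k).coeff (d + 1) * u (t - 1 - d) i with hc
  have hconv : (e * G i k).coeff t = (G i k).coeff 0 * u t i + ∑ d ∈ Finset.range t, c d := by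
    rw [mul_comm e, coeff_mul, Finset.Nat.sum_antidiagonal_eq_sum_range_succ_mk,
      Finset.sum_range_succ', add_comm]
    simp only [he, Nat.sub_zero, hc, Nat.sub_sub, add_comm 1]
  have hregister : ∑ d : Fin (mem G i), (G i k).coeff (d.val + 1) * stateAt G 0 u t i d =
      ∑ d ∈ Finset.range (mem G i), if d < t then c d else 0 := by
    rw [← Fin.sum_univ_eq_sum_range fun d => if d < t then c d else 0]
    simp only [stateAt_zero_apply, mul_ite, mul_zero, hc]
  rw [hconv, hregister, ← Finset.sum_filter, add_right_inj]
  refine (Finset.sum_subset (fun d hd => ?_) fun d hd hd' => ?_).symm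
  · exact Finset.mem_range.2 (Finset.mem_filter.1 hd).2
  · simp only [Finset.mem_filter, Finset.mem_range] at hd hd'
    have hmem : mem G i < d + 1 := Nat.lt_succ_of_le (not_lt.1 fun h => hd' ⟨h, hd⟩)
    simp only [hc, coeff_eq_zero_of_mem_lt G k hmem, zero_mul]

/-- The output streams of a finite input are the combination of the generator rows with the input
polynomials as coefficients. -/
lemma eq_zero_of_outBit_eq_zero {G : Gen p s} (hG : LinearIndependent (ZMod 2)[X] G)
    {u : ℕ → Inp p} {L : ℕ} (hu : ∀ t, L ≤ t → u t = 0)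
    (hout : ∀ t k, outBit G (stateAt G 0 u t) (u t) k = 0) : u = 0 := by
  set e : Fin p → (ZMod 2)[X] := fun i => ∑ t ∈ Finset.range L, monomial t (u t i) with he
  have hcoeff (i : Fin p) (t : ℕ) : (e i).coeff t = u t i := by
    simp only [he, finsetSum_coeff, coeff_monomial, Finset.sum_ite_eq', Finset.mem_range]
    split_ifs with h
    · rfl
    · rw [hu t (not_lt.1 h), Pi.zero_apply]
  have hsum : ∑ i, e i • G i = 0 := by
    funext k
    ext t
    simp only [Finset.sum_apply, Pi.smul_apply, smul_eq_mul, finsetSum_coeff, Pi.zero_apply,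
      coeff_zero]
    rw [← hout t k, outBit]
    exact Finset.sum_congr rfl fun i _ => coeff_mul_generator G i k (hcoeff i) t
  funext t i
  rw [← hcoeff i t, Fintype.linearIndependent_iff.1 hG e hsum i, coeff_zero, Pi.zero_apply,
    Pi.zero_apply]

/-! ### The difference system -/

/-- States of the difference system: the difference of two joint-encoder states together with the
difference of the network-encoder states. By linearity the product states of two paths enter the
error events and their distances only through this difference. -/
abbrev DiffState (G : Gen p s) := JState G × ZMod 2

variable [NeZero s]

/-- The relay code bits of one trellis step, as a stream of which the first `s` terms count. -/
def stepBits (G : Gen p s) (σ : JState G) (a : Inp p) (n : ℕ) : ZMod 2 :=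
  outBit G σ a (Fin.ofNat s n)

/-- One trellis step of the difference system. -/
def diffStep (G : Gen p s) (x : DiffState G) (a : Inp p) : DiffState G :=
  (nextState G x.1 a, x.2 + rscState (stepBits G x.1 a) s)

/-- Normalized squared distance over one symbol interval for phase state difference `w` and symbol
difference `δ`; it is an integer because the modulation index is an odd multiple of `1 / 2`. -/
def symbolCost (w δ : ZMod 2) : ℕ := if δ ≠ 0 then 1 else if w ≠ 0 then 2 else 0

/-- Normalized squared distance over one trellis step. -/
def stepCost (G : Gen p s) (x : DiffState G) (a : Inp p) : ℕ :=
  ∑ k ∈ Finset.range s, symbolCost (x.2 + rscState (stepBits G x.1 a) k) (stepBits G x.1 a k)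

/-- State of the difference system after `t` steps from `x` with input stream `u`. -/
def diffStateAt (G : Gen p s) (x : DiffState G) (u : ℕ → Inp p) : ℕ → DiffState G
  | 0 => x
  | t + 1 => diffStep G (diffStateAt G x u t) (u t)

/-- Normalized squared distance accumulated in the first `L` steps of the difference system. -/
def pathCost (G : Gen p s) (x : DiffState G) (u : ℕ → Inp p) (L : ℕ) : ℕ :=
  ∑ t ∈ Finset.range L, stepCost G (diffStateAt G x u t) (u t)

lemma symbol_block (G : Gen p s) (σ : JState G) (u : ℕ → Inp p) (t : ℕ) {k : ℕ} (hk : k < s) :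
    symbol G σ u (t * s + k) = stepBits G (stateAt G σ u t) (u t) k := by
  have hdiv : (t * s + k) / s = t := by
    rw [mul_comm, Nat.mul_add_div (NeZero.pos s), Nat.div_eq_of_lt hk, add_zero]
  have hmod : Fin.ofNat s (t * s + k) = Fin.ofNat s k := by
    ext; simp [Fin.ofNat]
  simp only [symbol, stepBits, hdiv, hmod]

lemma rscState_symbol_block (G : Gen p s) (σ : JState G) (u : ℕ → Inp p) (t : ℕ) {k : ℕ}
    (hk : k ≤ s) : rscState (symbol G σ u) (t * s + k) =
      rscState (symbol G σ u) (t * s) + rscState (stepBits G (stateAt G σ u t) (u t)) k := by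
  rw [rscState_add]
  congr 1
  exact rscState_congr fun i hi => symbol_block G σ u t (hi.trans_le hk)

lemma diffStateAt_eq_stateAt (G : Gen p s) (σ : JState G) (u : ℕ → Inp p) (t : ℕ) :
    diffStateAt G (σ, 0) u t = (stateAt G σ u t, rscState (symbol G σ u) (t * s)) := by
  induction t with
  | zero => simp [diffStateAt, stateAt, rscState]
  | succ t ih =>
    rw [diffStateAt, ih, diffStep, Nat.succ_mul, rscState_symbol_block G σ u t le_rfl]
    rfl

lemma pathCost_eq_sum_symbolCost (G : Gen p s) (σ : JState G) (u : ℕ → Inp p) (L : ℕ) :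
    pathCost G (σ, 0) u L =
      ∑ n ∈ Finset.range (L * s), symbolCost (rscState (symbol G σ u) n) (symbol G σ u n) := by
  induction L with
  | zero => simp [pathCost]
  | succ L ih =>
    rw [pathCost, Finset.sum_range_succ, ← pathCost, ih, Nat.succ_mul, Finset.sum_range_add,
      diffStateAt_eq_stateAt, stepCost]
    congr 1
    refine Finset.sum_congr rfl fun k hk => ?_
    rw [Finset.mem_range] at hk
    rw [rscState_symbol_block G σ u L hk.le, symbol_block G σ u L hk]

lemma stepBits_sub (G : Gen p s) (σ σ' : JState G) (a b : Inp p) :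
    stepBits G (σ - σ') (a - b) = stepBits G σ a - stepBits G σ' b := by
  funext n
  simp only [stepBits, outBit_sub, Pi.sub_apply]

lemma diffStep_sub (G : Gen p s) (x y : DiffState G) (a b : Inp p) :
    diffStep G (x - y) (a - b) = diffStep G x a - diffStep G y b := by
  ext1
  · simp [diffStep, nextState_sub]
  · simp only [diffStep, Prod.fst_sub, Prod.snd_sub, stepBits_sub, rscState_sub]
    ring

lemma diffStateAt_sub (G : Gen p s) (x y : DiffState G) (u v : ℕ → Inp p) (t : ℕ) :
    diffStateAt G (x - y) (u - v) t = diffStateAt G x u t - diffStateAt G y v t := by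
  induction t with
  | zero => rfl
  | succ t ih => simp only [diffStateAt, ih, Pi.sub_apply, diffStep_sub]

lemma isMerged_productState_iff (G : Gen p s) (σ : JState G) (u v : ℕ → Inp p) (t : ℕ) :
    IsMerged (productState G σ u v t) ↔ diffStateAt G 0 (u - v) t = 0 := by
  have hstate := stateAt_sub G σ σ u v t
  have hsymbol := symbol_sub G σ σ u v
  rw [sub_self] at hstate hsymbol
  rw [show (0 : DiffState G) = (0, 0) from rfl, diffStateAt_eq_stateAt, hstate, hsymbol,
    rscState_sub, Prod.mk.injEq, sub_eq_zero]
  rfl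

lemma diffStep_zero (G : Gen p s) : diffStep G 0 0 = 0 := by
  simpa using diffStep_sub G 0 0 0 0

lemma stepCost_zero (G : Gen p s) : stepCost G 0 0 = 0 := by
  have hbits : stepBits G 0 0 = 0 := by simpa using stepBits_sub G 0 0 0 0
  have hrsc (k : ℕ) : rscState 0 k = 0 := by simpa using rscState_sub 0 0 k
  simp [stepCost, hbits, hrsc, symbolCost]

lemma diffStateAt_zero_zero (G : Gen p s) (t : ℕ) : diffStateAt G 0 0 t = 0 := by
  simpa using diffStateAt_sub G 0 0 0 0 t

lemma pathCost_zero_zero (G : Gen p s) (t : ℕ) : pathCost G 0 0 t = 0 :=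
  Finset.sum_eq_zero fun _ _ => by rw [diffStateAt_zero_zero, Pi.zero_apply, stepCost_zero]

lemma diffStateAt_add (G : Gen p s) (x : DiffState G) (u : ℕ → Inp p) (a t : ℕ) :
    diffStateAt G x u (a + t) = diffStateAt G (diffStateAt G x u a) (fun n => u (a + n)) t := by
  induction t with
  | zero => rfl
  | succ t ih => rw [← add_assoc, diffStateAt, ih, diffStateAt]

lemma pathCost_add (G : Gen p s) (x : DiffState G) (u : ℕ → Inp p) (a t : ℕ) :
    pathCost G x u (a + t) =
      pathCost G x u a + pathCost G (diffStateAt G x u a) (fun n => u (a + n)) t := by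
  simp only [pathCost, Finset.sum_range_add, diffStateAt_add]

lemma diffStateAt_succ' (G : Gen p s) (x : DiffState G) (u : ℕ → Inp p) (t : ℕ) :
    diffStateAt G x u (t + 1) = diffStateAt G (diffStep G x (u 0)) (fun n => u (n + 1)) t := by
  rw [add_comm, diffStateAt_add]
  simp only [diffStateAt, add_comm]

lemma pathCost_succ' (G : Gen p s) (x : DiffState G) (u : ℕ → Inp p) (t : ℕ) :
    pathCost G x u (t + 1) =
      stepCost G x (u 0) + pathCost G (diffStep G x (u 0)) (fun n => u (n + 1)) t := by
  rw [add_comm, pathCost_add]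
  simp [pathCost, diffStateAt, add_comm]

lemma diffStateAt_congr (G : Gen p s) (x : DiffState G) {u v : ℕ → Inp p} {t : ℕ}
    (h : ∀ i < t, u i = v i) : diffStateAt G x u t = diffStateAt G x v t := by
  induction t with
  | zero => rfl
  | succ t ih =>
    rw [diffStateAt, diffStateAt, ih fun i hi => h i (hi.trans t.lt_succ_self), h t t.lt_succ_self]

lemma pathCost_congr (G : Gen p s) (x : DiffState G) {u v : ℕ → Inp p} {t : ℕ}
    (h : ∀ i < t, u i = v i) : pathCost G x u t = pathCost G x v t := by
  refine Finset.sum_congr rfl fun i hi => ?_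
  rw [Finset.mem_range] at hi
  rw [diffStateAt_congr G x fun j hj => h j (hj.trans hi), h i hi]

/-- The stream `u`, preceded by `a` zero inputs. -/
def delay (a : ℕ) (u : ℕ → Inp p) (n : ℕ) : Inp p := if n < a then 0 else u (n - a)

omit [NeZero s] in
lemma delay_add (a : ℕ) (u : ℕ → Inp p) : (fun n => delay a u (a + n)) = u := by
  funext n
  simp [delay]

lemma diffStateAt_delay_of_le (G : Gen p s) {a t : ℕ} (u : ℕ → Inp p) (h : t ≤ a) :
    diffStateAt G 0 (delay a u) t = 0 := by
  rw [diffStateAt_congr G 0 (u := delay a u) (v := 0) fun i hi => if_pos (hi.trans_le h),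
    diffStateAt_zero_zero]

lemma diffStateAt_delay_add (G : Gen p s) (u : ℕ → Inp p) (a t : ℕ) :
    diffStateAt G 0 (delay a u) (a + t) = diffStateAt G 0 u t := by
  rw [diffStateAt_add, diffStateAt_delay_of_le G u le_rfl, delay_add]

/-! ### Reachable difference states -/

/-- The state of the difference system can be reached from the zero state. -/
def Reachable (G : Gen p s) (x : DiffState G) : Prop := ∃ u t, diffStateAt G 0 u t = x

/-- The states of the difference system that can be reached from the zero state. -/
abbrev ReachableState (G : Gen p s) := {x : DiffState G // Reachable G x}

lemma reachable_zero (G : Gen p s) : Reachable G 0 := ⟨0, 0, rfl⟩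

lemma Reachable.diffStep {G : Gen p s} {x : DiffState G} (hx : Reachable G x) (a : Inp p) :
    Reachable G (diffStep G x a) := by
  obtain ⟨u, t, rfl⟩ := hx
  refine ⟨fun n => if n < t then u n else a, t + 1, ?_⟩
  rw [diffStateAt, diffStateAt_congr G 0 (v := u) fun i hi => by simp [hi]]
  simp

lemma Reachable.diffStateAt {G : Gen p s} {x : DiffState G} (hx : Reachable G x)
    (u : ℕ → Inp p) (t : ℕ) : Reachable G (diffStateAt G x u t) := by
  induction t with
  | zero => exact hx
  | succ t ih => exact ih.diffStep _

lemma exists_forall_reachable_exists_diffStateAt (G : Gen p s) :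
    ∃ n, ∀ x, Reachable G x → ∃ u, diffStateAt G 0 u n = x := by
  have := Fintype.ofFinite (ReachableState G)
  choose u τ hτ using fun x : ReachableState G => x.2
  refine ⟨Finset.univ.sup τ, fun x hx => ⟨delay (Finset.univ.sup τ - τ ⟨x, hx⟩) (u ⟨x, hx⟩), ?_⟩⟩
  have h := diffStateAt_delay_add G (u ⟨x, hx⟩) (Finset.univ.sup τ - τ ⟨x, hx⟩) (τ ⟨x, hx⟩)
  rwa [Nat.sub_add_cancel (Finset.le_sup (Finset.mem_univ _)), hτ] at h

/-- After `n` zero inputs the state is again reachable in exactly `n` steps; subtract an input that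
does so. -/
lemma Reachable.exists_diffStateAt_eq_zero {G : Gen p s} {x : DiffState G} (hx : Reachable G x) :
    ∃ u t, DistCPFSK.diffStateAt G x u t = 0 := by
  obtain ⟨n, hn⟩ := exists_forall_reachable_exists_diffStateAt G
  obtain ⟨v, hv⟩ := hn _ (hx.diffStateAt 0 n)
  refine ⟨0 - v, n, ?_⟩
  have h := diffStateAt_sub G x 0 0 v n
  rwa [sub_zero, hv, sub_self] at h

end Encoder

/-! ### Exponential decay of the weight of long paths -/

section PathWeights

variable {p s : ℕ}

lemma extend_cons_zero {L : ℕ} (a : Inp p) (w : Msg p L) :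
    extend (Fin.cons a w : Msg p (L + 1)) 0 = a := by
  simp [extend]

lemma extend_cons_succ {L : ℕ} (a : Inp p) (w : Msg p L) (t : ℕ) :
    extend (Fin.cons a w : Msg p (L + 1)) (t + 1) = extend w t := by
  simp only [extend, Nat.add_lt_add_iff_right]
  split_ifs with h
  · exact Fin.cons_succ (α := fun _ => Inp p) a w ⟨t, h⟩
  · rfl

lemma sum_msg_succ {M : Type*} [AddCommMonoid M] {L : ℕ} (f : Msg p (L + 1) → M) :
    ∑ w, f w = ∑ a : Inp p, ∑ w : Msg p L, f (Fin.cons a w) := by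
  rw [← Fintype.sum_prod_type' (fun (a : Inp p) (w : Msg p L) => f (Fin.cons a w))]
  exact (Fintype.sum_equiv (Fin.consEquiv fun _ => Inp p) _ _ fun _ => rfl).symm

variable [NeZero s]

lemma diffStateAt_cons (G : Gen p s) (x : DiffState G) {L : ℕ} (a : Inp p) (w : Msg p L) (t : ℕ) :
    diffStateAt G x (extend (Fin.cons a w : Msg p (L + 1))) (t + 1) =
      diffStateAt G (diffStep G x a) (extend w) t := by
  simp only [diffStateAt_succ', extend_cons_zero, extend_cons_succ]

lemma pathCost_cons (G : Gen p s) (x : DiffState G) {L : ℕ} (a : Inp p) (w : Msg p L) (t : ℕ) :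
    pathCost G x (extend (Fin.cons a w : Msg p (L + 1))) (t + 1) =
      stepCost G x a + pathCost G (diffStep G x a) (extend w) t := by
  simp only [pathCost_succ', extend_cons_zero, extend_cons_succ]

/-- The trajectory from `x` with input `u` avoids the zero state at the times `t` with
`0 < t < n`. -/
def Avoids (G : Gen p s) (x : DiffState G) (u : ℕ → Inp p) (n : ℕ) : Prop :=
  ∀ t, 0 < t → t < n → diffStateAt G x u t ≠ 0

/-- The trajectory from `x` with input word `w` is in the zero state at the end of `w` and at no
earlier positive time. -/
def HitsZero (G : Gen p s) (x : DiffState G) {L : ℕ} (w : Msg p L) : Prop :=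
  Avoids G x (extend w) L ∧ diffStateAt G x (extend w) L = 0

/-- `w` is the difference of the two paths of an error event. -/
def IsEvent (G : Gen p s) {L : ℕ} (w : Msg p L) : Prop :=
  0 < L ∧ extend w 0 ≠ 0 ∧ HitsZero G 0 w

/-- The difference words of error events. -/
abbrev EventWord (G : Gen p s) : Type := Σ L, {w : Msg p L // IsEvent G w}

lemma avoids_one (G : Gen p s) (x : DiffState G) (u : ℕ → Inp p) : Avoids G x u 1 :=
  fun _ h0 h1 => absurd h1 (Nat.not_lt.2 h0)

lemma avoids_cons {G : Gen p s} {x : DiffState G} {L n : ℕ} {a : Inp p} {w : Msg p L} :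
    Avoids G x (extend (Fin.cons a w : Msg p (L + 1))) (n + 2) ↔
      diffStep G x a ≠ 0 ∧ Avoids G (diffStep G x a) (extend w) (n + 1) := by
  constructor
  · intro h
    refine ⟨?_, fun t _ ht => ?_⟩
    · have h1 := h 1 one_pos (by omega)
      rwa [diffStateAt_cons] at h1
    · simpa only [diffStateAt_cons] using h (t + 1) t.succ_pos (by omega)
  · rintro ⟨h0, h⟩ (_ | _ | t) ht htn
    · exact absurd ht (lt_irrefl 0)
    · rwa [diffStateAt_cons]
    · rw [diffStateAt_cons]
      exact h (t + 1) t.succ_pos (by omega)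

lemma hitsZero_cons_iff {G : Gen p s} {x : DiffState G} {L : ℕ} {a : Inp p} {w : Msg p (L + 1)} :
    HitsZero G x (Fin.cons a w : Msg p (L + 2)) ↔
      diffStep G x a ≠ 0 ∧ HitsZero G (diffStep G x a) w := by
  rw [HitsZero, HitsZero, avoids_cons, diffStateAt_cons, and_assoc]

lemma hitsZero_cons_msg_zero_iff {G : Gen p s} {x : DiffState G} {a : Inp p} {w : Msg p 0} :
    HitsZero G x (Fin.cons a w : Msg p 1) ↔ diffStep G x a = 0 := by
  rw [HitsZero, diffStateAt_cons, and_iff_right (avoids_one G x _)]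
  rfl

lemma HitsZero.isEvent {G : Gen p s} {L : ℕ} {w : Msg p L} (h : HitsZero G 0 w) (hL : 1 < L) :
    IsEvent G w := by
  refine ⟨one_pos.trans hL, fun h0 => h.1 1 one_pos hL ?_, h⟩
  rw [diffStateAt, h0]
  exact diffStep_zero G

section Weights

open scoped ENNReal

variable (G : Gen p s) (ζ : ℝ≥0∞)

/-- The transition operator of the difference system with the weight `ζ ^ stepCost`, without the
transitions into the zero state. It acts on the reachable states only, because the zero state need
not be accessible from the others. -/
def avoidOp : Module.End ℝ≥0∞ (ReachableState G → ℝ≥0∞) where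
  toFun f x := ∑ a, if diffStep G x a = 0 then 0 else
    ζ ^ stepCost G x a * f ⟨diffStep G x a, x.2.diffStep a⟩
  map_add' f g := by
    funext x
    simp only [Pi.add_apply, ← Finset.sum_add_distrib, mul_add]
    exact Finset.sum_congr rfl fun a _ => by split_ifs <;> simp
  map_smul' c f := by
    funext x
    simp only [Pi.smul_apply, smul_eq_mul, RingHom.id_apply, Finset.mul_sum, mul_ite, mul_zero,
      mul_left_comm c]

/-- The total weight of the transitions of the difference system into the zero state. -/
def hitWeight (x : ReachableState G) : ℝ≥0∞ :=
  ∑ a, if diffStep G x a = 0 then ζ ^ stepCost G x a else 0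

lemma avoidOp_apply (f : ReachableState G → ℝ≥0∞) (x : ReachableState G) :
    avoidOp G ζ f x = ∑ a, if diffStep G x a = 0 then 0 else
      ζ ^ stepCost G x a * f ⟨diffStep G x a, x.2.diffStep a⟩ := rfl

open Classical in
lemma avoidOp_pow_one (n : ℕ) (x : ReachableState G) :
    (avoidOp G ζ ^ n) 1 x = ∑ w : Msg p n,
      if Avoids G x (extend w) (n + 1) then ζ ^ pathCost G x (extend w) n else 0 := by
  induction n generalizing x with
  | zero => simp [avoids_one, pathCost]
  | succ n ih =>
    rw [pow_succ', Module.End.mul_apply, avoidOp_apply, sum_msg_succ]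
    refine Finset.sum_congr rfl fun a _ => ?_
    simp only [avoids_cons, pathCost_cons, ih]
    split_ifs with h
    · simp [h]
    · simp [h, pow_add, Finset.mul_sum]

open Classical in
lemma avoidOp_pow_hitWeight (n : ℕ) (x : ReachableState G) :
    (avoidOp G ζ ^ n) (hitWeight G ζ) x = ∑ w : Msg p (n + 1),
      if HitsZero G x w then ζ ^ pathCost G x (extend w) (n + 1) else 0 := by
  induction n generalizing x with
  | zero =>
    rw [sum_msg_succ]
    refine Finset.sum_congr rfl fun a _ => ?_
    simp only [Fintype.sum_unique, hitsZero_cons_msg_zero_iff, pathCost_cons]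
    simp [pathCost]
  | succ n ih =>
    rw [pow_succ', Module.End.mul_apply, avoidOp_apply, sum_msg_succ]
    refine Finset.sum_congr rfl fun a _ => ?_
    simp only [hitsZero_cons_iff, pathCost_cons, ih]
    split_ifs with h
    · simp [h]
    · simp [h, pow_add, Finset.mul_sum]

variable {G ζ}

lemma hitWeight_ne_top (hζ : ζ ≠ ∞) (x : ReachableState G) : hitWeight G ζ x ≠ ∞ := by
  refine ENNReal.sum_ne_top.2 fun a _ => ?_
  split_ifs
  · exact ENNReal.pow_ne_top hζ
  · exact ENNReal.zero_ne_top

lemma Reachable.exists_hitsZero {x : DiffState G} (hx : Reachable G x) :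
    ∃ n, ∃ w : Msg p (n + 1), HitsZero G x w := by
  classical
  have hex : ∃ n u, DistCPFSK.diffStateAt G x u (n + 1) = 0 := by
    obtain ⟨u, t, h⟩ := (hx.diffStep 0).exists_diffStateAt_eq_zero
    exact ⟨t, delay 1 u, by simpa [diffStateAt_succ', delay] using h⟩
  obtain ⟨u, hu⟩ := Nat.find_spec hex
  set n := Nat.find hex
  have hagree (t : ℕ) (ht : t ≤ n + 1) : DistCPFSK.diffStateAt G x
      (extend fun i : Fin (n + 1) => u i) t = DistCPFSK.diffStateAt G x u t :=
    diffStateAt_congr G x fun i hi => extend_of_lt _ (hi.trans_le ht)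
  refine ⟨n, fun i => u i, fun t ht htn h => ?_, by rw [hagree _ le_rfl, hu]⟩
  obtain ⟨t, rfl⟩ := Nat.exists_eq_succ_of_ne_zero ht.ne'
  exact Nat.find_min hex (m := t) (by omega) ⟨_, h⟩

lemma potential_hitWeight_ne_zero (hζ : ζ ≠ 0) (x : ReachableState G) :
    potential (avoidOp G ζ) (hitWeight G ζ) x ≠ 0 := by
  classical
  obtain ⟨n, w, hw⟩ := x.2.exists_hitsZero
  intro h
  have hsum := ENNReal.tsum_eq_zero.1 h n
  rw [avoidOp_pow_hitWeight, Finset.sum_eq_zero_iff] at hsum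
  have hterm := hsum w (Finset.mem_univ w)
  rw [if_pos hw] at hterm
  exact pow_ne_zero _ hζ hterm

open Classical in
lemma tsum_eventWord (f : (L : ℕ) → Msg p L → ℝ≥0∞) :
    ∑' e : EventWord G, f e.1 e.2.1 = ∑' L, ∑ w : Msg p L, if IsEvent G w then f L w else 0 := by
  rw [ENNReal.tsum_sigma (fun L (w : {w : Msg p L // IsEvent G w}) => f L w.1)]
  refine tsum_congr fun L => ?_
  rw [tsum_fintype, ← Finset.sum_filter]
  exact (Finset.sum_subtype _ (by simp) _).symm

lemma potential_hitWeight_zero_ne_top (hζ : ζ ≠ ∞)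
    (h : ∑' e : EventWord G, ζ ^ pathCost G 0 (extend e.2.1) e.1 ≠ ∞) :
    potential (avoidOp G ζ) (hitWeight G ζ) ⟨0, reachable_zero G⟩ ≠ ∞ := by
  classical
  rw [potential, tsum_eq_zero_add' ENNReal.summable]
  refine ENNReal.add_ne_top.2 ⟨hitWeight_ne_top hζ _, ne_top_of_le_ne_top h ?_⟩
  rw [tsum_eventWord (fun L w => ζ ^ pathCost G 0 (extend w) L)]
  refine le_trans (ENNReal.tsum_le_tsum fun n => ?_) (ENNReal.tsum_comp_le_tsum_of_injective
    (add_left_injective 2)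
    fun L => ∑ w : Msg p L, if IsEvent G w then ζ ^ pathCost G 0 (extend w) L else 0)
  rw [avoidOp_pow_hitWeight]
  refine Finset.sum_le_sum fun w _ => ?_
  by_cases hw : HitsZero G 0 w
  · rw [if_pos hw, if_pos (hw.isEvent (by omega))]
  · rw [if_neg hw]
    exact zero_le

lemma potential_hitWeight_ne_top (hζ0 : ζ ≠ 0) (hζ : ζ ≠ ∞)
    (h : ∑' e : EventWord G, ζ ^ pathCost G 0 (extend e.2.1) e.1 ≠ ∞) (x : ReachableState G) :
    potential (avoidOp G ζ) (hitWeight G ζ) x ≠ ∞ := by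
  suffices ∀ u t, potential (avoidOp G ζ) (hitWeight G ζ)
      ⟨diffStateAt G 0 u t, (reachable_zero G).diffStateAt u t⟩ ≠ ∞ by
    obtain ⟨_, u, t, rfl⟩ := x
    exact this u t
  intro u t
  induction t with
  | zero => exact potential_hitWeight_zero_ne_top hζ h
  | succ t ih =>
    by_cases h0 : diffStateAt G 0 u (t + 1) = 0
    · simp only [h0]
      exact potential_hitWeight_zero_ne_top hζ h
    · intro htop
      rw [potential_eq_add] at ih
      refine ih (ENNReal.add_eq_top.2 (Or.inr ?_))
      rw [avoidOp_apply, ENNReal.sum_eq_top]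
      refine ⟨u t, Finset.mem_univ _, ?_⟩
      exact (if_neg h0).trans ((congrArg _ htop).trans (ENNReal.mul_top (pow_ne_zero _ hζ0)))

theorem exists_sum_weight_le (hζ0 : ζ ≠ 0) (hζ : ζ ≠ ∞)
    (h : ∑' e : EventWord G, ζ ^ pathCost G 0 (extend e.2.1) e.1 ≠ ∞) :
    ∃ ρ C : ℝ≥0∞, ρ < 1 ∧ C ≠ ∞ ∧ ∀ n,
      (∑ w : Msg p n, open Classical in
        if Avoids G 0 (extend w) (n + 1) then ζ ^ pathCost G 0 (extend w) n else 0) ≤ C * ρ ^ n ∧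
      (∑ w : Msg p (n + 1), open Classical in
        if IsEvent G w then ζ ^ pathCost G 0 (extend w) (n + 1) else 0) ≤ C * ρ ^ n := by
  classical
  have := Fintype.ofFinite (ReachableState G)
  obtain ⟨ρ, C, hρ, hC, hdecay⟩ := exists_pow_apply_one_le
    (potential_one_ne_top (potential_hitWeight_ne_zero hζ0) (potential_hitWeight_ne_top hζ0 hζ h))
  set B : ℝ≥0∞ := ∑ x, hitWeight G ζ x
  have hBtop : B ≠ ∞ := ENNReal.sum_ne_top.2 fun x _ => hitWeight_ne_top hζ x
  have hdecay0 (n : ℕ) : (avoidOp G ζ ^ n) 1 ⟨0, reachable_zero G⟩ ≤ C * ρ ^ n := by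
    simpa using hdecay n ⟨0, reachable_zero G⟩
  have hhit : hitWeight G ζ ≤ B • 1 := fun x => by
    simpa using Finset.single_le_sum (f := hitWeight G ζ) (fun _ _ => zero_le) (Finset.mem_univ x)
  refine ⟨ρ, (1 + B) * C, hρ, ENNReal.mul_ne_top (by simp [hBtop]) hC, fun n => ⟨?_, ?_⟩⟩
  · refine (avoidOp_pow_one G ζ n ⟨0, reachable_zero G⟩).ge.trans ((hdecay0 n).trans ?_)
    gcongr
    exact le_mul_of_one_le_left zero_le le_self_add
  · calc (∑ w : Msg p (n + 1), if IsEvent G w then ζ ^ pathCost G 0 (extend w) (n + 1) else 0)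
        ≤ ∑ w : Msg p (n + 1), if HitsZero G 0 w then ζ ^ pathCost G 0 (extend w) (n + 1) else 0 :=
          Finset.sum_le_sum fun w _ => by
            split_ifs with hevent hhit
            exacts [le_rfl, absurd hevent.2.2 hhit, zero_le, le_rfl]
      _ = (avoidOp G ζ ^ n) (hitWeight G ζ) ⟨0, reachable_zero G⟩ :=
          (avoidOp_pow_hitWeight G ζ n ⟨0, reachable_zero G⟩).symm
      _ ≤ (avoidOp G ζ ^ n) (B • 1) ⟨0, reachable_zero G⟩ :=
          linearMap_monotone (avoidOp G ζ ^ n) hhit _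
      _ ≤ B * (C * ρ ^ n) := by
          rw [map_smul, Pi.smul_apply, smul_eq_mul]
          gcongr
          exact hdecay0 n
      _ ≤ (1 + B) * C * ρ ^ n := by
          rw [← mul_assoc]
          gcongr
          exact le_add_self

end Weights

end PathWeights

/-! ### Distances of CPFSK signals -/

section Signals

variable {p s : ℕ}

/-- Unit-amplitude CPFSK signal of a symbol stream; `envelope` is the signal of a relay code
stream. -/
def cpfsk (K : ℕ) (T : ℝ) (μ : ℕ → ZMod 2) (t : ℝ) : ℂ :=
  Complex.exp (Complex.I * (phase K T μ t : ℂ))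

lemma measurable_phase (K : ℕ) (T : ℝ) (μ : ℕ → ZMod 2) : Measurable (phase K T μ) := by
  have hfloor : Measurable fun t : ℝ => ⌊t / T⌋₊ := Nat.measurable_floor.comp (by fun_prop)
  have hcomp (g : ℕ → ℝ) : Measurable fun t : ℝ => g ⌊t / T⌋₊ :=
    (Measurable.of_discrete (f := g)).comp hfloor
  have := hcomp fun n => (rscState μ n).val
  have := hcomp fun n => (μ n).val
  have := hcomp fun n => n
  unfold phase phaseResponse
  fun_prop

lemma measurable_cpfsk (K : ℕ) (T : ℝ) (μ : ℕ → ZMod 2) : Measurable (cpfsk K T μ) := by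
  have := measurable_phase K T μ
  unfold cpfsk
  fun_prop

lemma norm_cpfsk (K : ℕ) (T : ℝ) (μ : ℕ → ZMod 2) (t : ℝ) : ‖cpfsk K T μ t‖ = 1 :=
  Complex.norm_exp_I_mul_ofReal _

lemma norm_exp_sub_exp_sq (α β : ℝ) :
    ‖Complex.exp (Complex.I * (α : ℂ)) - Complex.exp (Complex.I * (β : ℂ))‖ ^ 2 =
      2 - 2 * Real.cos (α - β) := by
  rw [← Complex.normSq_eq_norm_sq, mul_comm, mul_comm Complex.I, Complex.normSq_apply]
  simp only [Complex.sub_re, Complex.sub_im, Complex.exp_ofReal_mul_I_re,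
    Complex.exp_ofReal_mul_I_im, Real.cos_sub]
  linear_combination Real.sin_sq_add_cos_sq α + Real.sin_sq_add_cos_sq β

lemma integral_cos_eq_zero {K : ℕ} (hK : Odd K) (a : ℤ) {b : ℤ} (hb : b ≠ 0) :
    ∫ r in (0 : ℝ)..1, Real.cos (Real.pi * K * (a + b * r)) = 0 := by
  have hK0 : (K : ℝ) ≠ 0 := by exact_mod_cast hK.pos.ne'
  have hcoeff : Real.pi * K * b ≠ 0 :=
    mul_ne_zero (mul_ne_zero Real.pi_ne_zero hK0) (by exact_mod_cast hb)
  have hsin (c : ℤ) : Real.sin (Real.pi * K * c) = 0 := by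
    rw [mul_assoc, mul_comm]
    exact_mod_cast Real.sin_int_mul_pi (K * c)
  calc ∫ r in (0 : ℝ)..1, Real.cos (Real.pi * K * (a + b * r))
      = ∫ r in (0 : ℝ)..1, Real.cos (Real.pi * K * a + Real.pi * K * b * r) := by
        simp only [mul_add, mul_assoc]
    _ = (Real.pi * K * b)⁻¹ * (Real.sin (Real.pi * K * (a + b : ℤ)) -
          Real.sin (Real.pi * K * a)) := by
        rw [intervalIntegral.integral_comp_add_mul (fun x => Real.cos x) hcoeff, integral_cos,
          smul_eq_mul]
        push_cast
        ring_nf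
    _ = 0 := by rw [hsin, hsin, sub_zero, mul_zero]

lemma zmod_two_val_sub_val {x y : ZMod 2} (h : x ≠ y) :
    (x.val : ℤ) - y.val = 1 ∨ (x.val : ℤ) - y.val = -1 := by
  revert x y
  decide

lemma integral_two_sub_two_mul_cos {K : ℕ} (hK : Odd K) (w w' δ δ' : ZMod 2) :
    ∫ r in (0 : ℝ)..1, (2 - 2 * Real.cos (Real.pi * K *
        (((w.val : ℤ) - w'.val : ℤ) + ((δ.val : ℤ) - δ'.val : ℤ) * r))) =
      2 * symbolCost (w - w') (δ - δ') := by
  obtain rfl | hδ := eq_or_ne δ δ'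
  · have hodd : Real.cos (Real.pi * K) = -1 := by rw [mul_comm, Real.cos_nat_mul_pi, hK.neg_one_pow]
    obtain rfl | hw := eq_or_ne w w'
    · simp [symbolCost]
    · have hcost : symbolCost (w - w') (δ - δ) = 2 := by simp [symbolCost, sub_ne_zero.2 hw]
      rw [hcost]
      rcases zmod_two_val_sub_val hw with h | h <;> rw [h] <;> norm_num [hodd]
  · have hb : (δ.val : ℤ) - δ'.val ≠ 0 := by rcases zmod_two_val_sub_val hδ with h | h <;> omega
    have hcost : symbolCost (w - w') (δ - δ') = 1 := if_pos (sub_ne_zero.2 hδ)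
    rw [intervalIntegral.integral_sub (by simp)
      (Continuous.intervalIntegrable (by fun_prop) _ _), intervalIntegral.integral_const_mul,
      integral_cos_eq_zero hK _ hb, hcost]
    simp

lemma norm_cpfsk_sub_sq (K : ℕ) {T : ℝ} (hT : 0 < T) (μ ν : ℕ → ZMod 2) {n : ℕ} {t : ℝ}
    (hle : n * T ≤ t) (hlt : t < (n + 1) * T) :
    ‖cpfsk K T μ t - cpfsk K T ν t‖ ^ 2 = 2 - 2 * Real.cos (Real.pi * K *
      ((((rscState μ n).val : ℤ) - (rscState ν n).val : ℤ) +
        (((μ n).val : ℤ) - (ν n).val : ℤ) * (t / T - n))) := by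
  have hfloor : ⌊t / T⌋₊ = n :=
    (Nat.floor_eq_iff (div_nonneg ((by positivity : (0 : ℝ) ≤ n * T).trans hle) hT.le)).2
      ⟨(le_div_iff₀ hT).2 hle, (div_lt_iff₀ hT).2 hlt⟩
  simp only [cpfsk, norm_exp_sub_exp_sq, phase, hfloor, phaseResponse]
  congr 3
  push_cast
  field_simp
  ring

lemma integral_norm_cpfsk_sub_sq_symbol {K : ℕ} (hK : Odd K) {T : ℝ} (hT : 0 < T)
    (μ ν : ℕ → ZMod 2) (n : ℕ) :
    ∫ t in (n * T : ℝ)..((n + 1) * T), ‖cpfsk K T μ t - cpfsk K T ν t‖ ^ 2 =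
      2 * T * symbolCost (rscState μ n - rscState ν n) (μ n - ν n) := by
  rw [intervalIntegral.integral_congr_Ioo_of_le (by nlinarith)
    fun t ht => norm_cpfsk_sub_sq K hT μ ν ht.1.le ht.2,
    intervalIntegral.integral_comp_div_sub (fun r : ℝ => 2 - 2 * Real.cos (Real.pi * K *
      ((((rscState μ n).val : ℤ) - (rscState ν n).val : ℤ) +
        (((μ n).val : ℤ) - (ν n).val : ℤ) * r))) hT.ne',
    mul_div_cancel_right₀ _ hT.ne', mul_div_cancel_right₀ _ hT.ne', sub_self, add_sub_cancel_left,
    integral_two_sub_two_mul_cos hK, smul_eq_mul]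
  ring

lemma intervalIntegrable_norm_cpfsk_sub_sq (K : ℕ) (T : ℝ) (μ ν : ℕ → ZMod 2) (a b : ℝ) :
    IntervalIntegrable (fun t => ‖cpfsk K T μ t - cpfsk K T ν t‖ ^ 2) volume a b := by
  have hμ := measurable_cpfsk K T μ
  have hν := measurable_cpfsk K T ν
  have hbound (t : ℝ) : ‖cpfsk K T μ t - cpfsk K T ν t‖ ≤ 2 :=
    (norm_sub_le _ _).trans_eq (by rw [norm_cpfsk, norm_cpfsk]; norm_num)
  rw [intervalIntegrable_iff, Set.uIoc]
  refine Integrable.of_bound (by fun_prop) (2 ^ 2) (Eventually.of_forall fun t => ?_)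
  rw [Real.norm_of_nonneg (by positivity)]
  exact pow_le_pow_left₀ (norm_nonneg _) (hbound t) 2

lemma integral_norm_cpfsk_sub_sq {K : ℕ} (hK : Odd K) {T : ℝ} (hT : 0 < T) (μ ν : ℕ → ZMod 2)
    (n : ℕ) :
    ∫ t in (0 : ℝ)..(n * T), ‖cpfsk K T μ t - cpfsk K T ν t‖ ^ 2 =
      2 * T * ∑ i ∈ Finset.range n, (symbolCost (rscState (μ - ν) i) ((μ - ν) i) : ℝ) := by
  have h := intervalIntegral.sum_integral_adjacent_intervals (n := n)
    (a := fun n : ℕ => (n * T : ℝ)) (f := fun t => ‖cpfsk K T μ t - cpfsk K T ν t‖ ^ 2)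
    (fun k _ => intervalIntegrable_norm_cpfsk_sub_sq K T μ ν _ _)
  simp only [Nat.cast_zero, zero_mul] at h
  rw [← h, Finset.mul_sum]
  refine Finset.sum_congr rfl fun i _ => ?_
  rw [rscState_sub, Pi.sub_apply, ← integral_norm_cpfsk_sub_sq_symbol hK hT, Nat.cast_succ]

variable [NeZero s]

lemma integral_norm_envelope_sub_sq (G : Gen p s) {K : ℕ} (hK : Odd K) {T : ℝ} (hT : 0 < T)
    (σ : JState G) (u v : ℕ → Inp p) (L : ℕ) :
    ∫ t in (0 : ℝ)..(L * s * T), ‖envelope G K T σ u t - envelope G K T σ v t‖ ^ 2 =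
      2 * T * pathCost G 0 (u - v) L := by
  have hsymbol := symbol_sub G σ σ u v
  rw [sub_self] at hsymbol
  rw [show (0 : DiffState G) = (0, 0) from rfl, pathCost_eq_sum_symbolCost, hsymbol]
  push_cast
  rw [← integral_norm_cpfsk_sub_sq hK hT]
  push_cast
  rfl

lemma ErrorEvent.nsed_eq_pathCost {G : Gen p s} (e : ErrorEvent G) {K : ℕ} (hK : Odd K) {T : ℝ}
    (hT : 0 < T) : e.nsed K T = pathCost G 0 (extend (e.sent - e.decoded)) e.len := by
  rw [ErrorEvent.nsed, integral_norm_envelope_sub_sq G hK hT, extend_sub]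
  field_simp

/-! ### Correlations of signals -/

lemma integrable_re_conj_mul {f g : ℝ → ℂ} (hf : MemLp f 2) (hg : MemLp g 2) :
    Integrable fun t => ((starRingEnd ℂ) (f t) * g t).re :=
  (MemLp.integrable_mul hf.star hg).re

lemma corr_comm (f g : ℝ → ℂ) : corr f g = corr g f := by
  refine integral_congr_ae (Eventually.of_forall fun t => ?_)
  simp only [Complex.mul_re, Complex.conj_re, Complex.conj_im]
  ring

lemma corr_sub_right {f g h : ℝ → ℂ} (hf : MemLp f 2) (hg : MemLp g 2) (hh : MemLp h 2) :
    corr f (g - h) = corr f g - corr f h := by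
  simp only [corr, ← integral_sub (integrable_re_conj_mul hf hg) (integrable_re_conj_mul hf hh),
    Pi.sub_apply, mul_sub, Complex.sub_re]

lemma corr_sub_left {f g h : ℝ → ℂ} (hf : MemLp f 2) (hg : MemLp g 2) (hh : MemLp h 2) :
    corr (f - g) h = corr f h - corr g h := by
  rw [corr_comm, corr_sub_right hh hf hg, corr_comm h, corr_comm h]

lemma corr_self (f : ℝ → ℂ) : corr f f = ∫ t, ‖f t‖ ^ 2 := by
  refine integral_congr_ae (Eventually.of_forall fun t => ?_)
  simp only [mul_comm _ (f t), Complex.mul_conj, Complex.ofReal_re, Complex.normSq_eq_norm_sq]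

lemma norm_envelope (G : Gen p s) (K : ℕ) (T : ℝ) (σ : JState G) (u : ℕ → Inp p) (t : ℝ) :
    ‖envelope G K T σ u t‖ = 1 := norm_cpfsk K T (symbol G σ u) t

lemma memLp_signal (G : Gen p s) (K : ℕ) (T Es : ℝ) {N : ℕ} (u : Msg p N) :
    MemLp (signal G K T Es u) 2 := by
  rw [signal, memLp_indicator_iff_restrict measurableSet_Ico]
  refine MemLp.of_bound (((measurable_cpfsk K T (symbol G 0 (extend u))).const_mul
    _).aestronglyMeasurable) (√(2 * Es / T)) (Eventually.of_forall fun t => ?_)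
  rw [norm_mul, norm_envelope, mul_one, Complex.norm_real, Real.norm_of_nonneg (Real.sqrt_nonneg _)]

lemma norm_signal_sub_sq (G : Gen p s) (K : ℕ) {T Es : ℝ} (hT : 0 < T) (hEs : 0 < Es) {N : ℕ}
    (u v : Msg p N) (t : ℝ) : ‖(signal G K T Es u - signal G K T Es v) t‖ ^ 2 =
      (Set.Ico (0 : ℝ) (N * s * T)).indicator (fun t => 2 * Es / T *
        ‖envelope G K T 0 (extend u) t - envelope G K T 0 (extend v) t‖ ^ 2) t := by
  rw [Pi.sub_apply, signal, signal, Set.indicator, Set.indicator, Set.indicator]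
  split_ifs
  · rw [← mul_sub, norm_mul, mul_pow, Complex.norm_real, Real.norm_of_nonneg (Real.sqrt_nonneg _),
      Real.sq_sqrt (by positivity)]
  · simp

lemma corr_signal_self (G : Gen p s) (K : ℕ) (T Es : ℝ) {N : ℕ} (u v : Msg p N) :
    corr (signal G K T Es u) (signal G K T Es u) =
      corr (signal G K T Es v) (signal G K T Es v) := by
  rw [corr_self, corr_self]
  refine integral_congr_ae (Eventually.of_forall fun t => ?_)
  simp only [signal, norm_indicator_eq_indicator_norm, norm_mul, norm_envelope]

lemma corr_signal_sub (G : Gen p s) {K : ℕ} (hK : Odd K) {T Es : ℝ} (hT : 0 < T) (hEs : 0 < Es)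
    {N : ℕ} (u v : Msg p N) :
    corr (signal G K T Es u - signal G K T Es v) (signal G K T Es u - signal G K T Es v) =
      4 * Es * pathCost G 0 (extend u - extend v) N := by
  have h := integral_norm_envelope_sub_sq G hK hT 0 (extend u) (extend v) N
  rw [intervalIntegral.integral_of_le (by positivity), ← integral_Ico_eq_integral_Ioc] at h
  simp only [corr_self, norm_signal_sub_sq G K hT hEs]
  rw [integral_indicator measurableSet_Ico, integral_const_mul, h]
  field_simp
  ring

end Signals

/-! ### White noise -/

section Noise

variable {p s : ℕ}

section WhiteNoise

variable {Ω : Type*} [MeasurableSpace Ω] {P : Measure Ω} {N0 : ℝ}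
  {Z : (ℝ → ℂ) → Ω → ℝ} (hZ : IsWhiteNoise P N0 Z) {f g f' g' : ℝ → ℂ}
include hZ

lemma IsWhiteNoise.memLp (hf : MemLp f 2) : MemLp (Z f) 2 P :=
  (hZ.gaussian.hasGaussianLaw_eval ⟨f, hf⟩).memLp_two

lemma IsWhiteNoise.hasGaussianLaw_sub (hf : MemLp f 2) (hg : MemLp g 2) :
    HasGaussianLaw (Z f - Z g) P :=
  hZ.gaussian.hasGaussianLaw_sub (s := ⟨f, hf⟩) (t := ⟨g, hg⟩)

variable [IsProbabilityMeasure P]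

lemma IsWhiteNoise.integral_sub (hf : MemLp f 2) (hg : MemLp g 2) :
    ∫ ω, (Z f - Z g) ω ∂P = 0 := by
  simp only [Pi.sub_apply]
  rw [MeasureTheory.integral_sub ((hZ.memLp hf).integrable (by norm_num))
    ((hZ.memLp hg).integrable (by norm_num)), hZ.mean f hf, hZ.mean g hg, sub_zero]

lemma IsWhiteNoise.covariance_sub (hf : MemLp f 2) (hg : MemLp g 2) (hf' : MemLp f' 2)
    (hg' : MemLp g' 2) : cov[Z f - Z g, Z f' - Z g'; P] = N0 * corr (f - g) (f' - g') := by
  rw [covariance_sub_sub (hZ.memLp hf) (hZ.memLp hg) (hZ.memLp hf') (hZ.memLp hg'),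
    hZ.covariance _ _ hf hf', hZ.covariance _ _ hf hg', hZ.covariance _ _ hg hf',
    hZ.covariance _ _ hg hg', corr_sub_left hf hg (hf'.sub hg'), corr_sub_right hf hf' hg',
    corr_sub_right hg hf' hg']
  ring

lemma IsWhiteNoise.variance_sub (hf : MemLp f 2) (hg : MemLp g 2) :
    Var[Z f - Z g; P] = N0 * corr (f - g) (f - g) := by
  rw [← covariance_self (hZ.hasGaussianLaw_sub hf hg).aemeasurable, hZ.covariance_sub hf hg hf hg]

/-- `Z` is additive almost surely, because both sides have the same mean and the difference has
variance zero. -/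
lemma IsWhiteNoise.sub_ae_eq (hf : MemLp f 2) (hg : MemLp g 2) (hf' : MemLp f' 2)
    (hg' : MemLp g' 2) (h : f - g = f' - g') : ∀ᵐ ω ∂P, Z f ω - Z g ω = Z f' ω - Z g' ω := by
  have hL2 := (hZ.memLp hf).sub (hZ.memLp hg)
  have hL2' := (hZ.memLp hf').sub (hZ.memLp hg')
  have hvar : Var[(Z f - Z g) - (Z f' - Z g'); P] = 0 := by
    rw [ProbabilityTheory.variance_sub hL2 hL2', hZ.variance_sub hf hg, hZ.variance_sub hf' hg',
      hZ.covariance_sub hf hg hf' hg', h]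
    ring
  have hmean : ∫ ω, ((Z f - Z g) - (Z f' - Z g')) ω ∂P = 0 := by
    simp only [Pi.sub_apply (Z f - Z g)]
    rw [MeasureTheory.integral_sub (hL2.integrable (by norm_num)) (hL2'.integrable (by norm_num)),
      hZ.integral_sub hf hg, hZ.integral_sub hf' hg', sub_zero]
  filter_upwards [ae_eq_integral_of_variance_eq_zero (hL2.sub hL2') hvar] with ω hω
  rwa [hmean, Pi.sub_apply, sub_eq_zero] at hω

lemma IsWhiteNoise.measureReal_le_sub (hf : MemLp f 2) (hg : MemLp g 2)
    (hpos : 0 < N0 * corr (f - g) (f - g)) (t : ℝ) :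
    P.real {ω | t ≤ Z f ω - Z g ω} = gaussQ (t / √(N0 * corr (f - g) (f - g))) := by
  have hlaw := hZ.hasGaussianLaw_sub hf hg
  have hmap := hlaw.map_eq_gaussianReal
  rw [hZ.integral_sub hf hg, hZ.variance_sub hf hg] at hmap
  have h := gaussianReal_zero_real_Ici (v := (N0 * corr (f - g) (f - g)).toNNReal)
    (Real.toNNReal_pos.2 hpos).ne' t
  rwa [← hmap, Real.coe_toNNReal _ hpos.le,
    map_measureReal_apply_of_aemeasurable hlaw.aemeasurable measurableSet_Ici] at h

end WhiteNoise

variable [NeZero s]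

lemma measureReal_received_le {Ω : Type*} [MeasurableSpace Ω] {P : Measure Ω}
    [IsProbabilityMeasure P] {N0 : ℝ} {Z : (ℝ → ℂ) → Ω → ℝ} (hZ : IsWhiteNoise P N0 Z)
    (hN0 : 0 < N0) (G : Gen p s) {K : ℕ} (hK : Odd K) {T Es : ℝ} (hT : 0 < T) (hEs : 0 < Es)
    {N : ℕ} (u v : Msg p N) (hcost : pathCost G 0 (extend v - extend u) N ≠ 0) :
    P.real {ω | received G K T Es Z u ω u ≤ received G K T Es Z u ω v} =
      gaussQ √(pathCost G 0 (extend v - extend u) N * (Es / N0)) := by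
  have hu := memLp_signal G K T Es u
  have hv := memLp_signal G K T Es v
  have hdist := corr_signal_sub G hK hT hEs v u
  set D : ℝ := ((pathCost G 0 (extend v - extend u) N : ℕ) : ℝ)
  have hDpos : 0 < D := by positivity
  have hcorr := hdist
  rw [corr_sub_left hv hu (hv.sub hu), corr_sub_right hv hv hu, corr_sub_right hu hv hu,
    corr_signal_self G K T Es v u, corr_comm (signal G K T Es v)] at hcorr
  have hset : {ω | received G K T Es Z u ω u ≤ received G K T Es Z u ω v} =
      {ω | 2 * Es * D ≤ Z (signal G K T Es v) ω - Z (signal G K T Es u) ω} := by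
    ext ω
    simp only [received, Set.mem_ofPred_eq]
    constructor <;> intro h <;> linarith
  have hvar : N0 * (4 * Es * D) = (2 * Es * D) ^ 2 / (D * (Es / N0)) := by
    field_simp
    norm_num
  rw [hset, hZ.measureReal_le_sub hv hu (by rw [hdist]; positivity), hdist, hvar,
    Real.sqrt_div (by positivity), Real.sqrt_sq (by positivity), div_div_cancel₀ (by positivity)]

end Noise

/-! ### The transfer function as a sum over difference words -/

section TransferFunction

variable {p s : ℕ}

lemma bitErrors_eq_bitErrors_sub_zero {N : ℕ} (u v : Msg p N) :
    bitErrors u v = bitErrors (u - v) 0 := by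
  simp [bitErrors, sub_eq_zero]

lemma bitErrors_le {N : ℕ} (u v : Msg p N) : bitErrors u v ≤ p * N := by
  refine (Finset.card_filter_le _ _).trans ?_
  simp [mul_comm]

lemma tsum_natCard_fiber_mul {α β : Type*} (g : α → β) (hg : ∀ b, Finite {a // g a = b})
    (f : β → ENNReal) : ∑' b, (Nat.card {a // g a = b} : ENNReal) * f b = ∑' a, f (g a) := by
  rw [← (Equiv.sigmaFiberEquiv g).tsum_eq, ENNReal.tsum_sigma']
  refine tsum_congr fun b => ?_
  have hfiber (a : {a // g a = b}) : f (g (Equiv.sigmaFiberEquiv g ⟨b, a⟩)) = f b :=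
    congrArg f a.2
  simp only [hfiber, ENNReal.tsum_const, ENat.card_eq_coe_natCard, ENat.toENNReal_coe]

lemma card_jState (G : Gen p s) : Fintype.card (JState G) = 2 ^ memory G := by
  simp [Fintype.card_pi, memory, Finset.prod_pow_eq_pow_sum]

lemma card_msg (p N : ℕ) : Fintype.card (Msg p N) = 2 ^ (p * N) := by
  simp [pow_mul]

variable [NeZero s] {G : Gen p s}

lemma isEvent_sub_iff (σ : JState G) {L : ℕ} (u v : Msg p L) :
    IsEvent G (u - v) ↔ 0 < L ∧ extend u 0 ≠ extend v 0 ∧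
      (∀ t, 0 < t → t < L → ¬ IsMerged (productState G σ (extend u) (extend v) t)) ∧
      IsMerged (productState G σ (extend u) (extend v) L) := by
  simp only [IsEvent, HitsZero, Avoids, extend_sub, isMerged_productState_iff, Pi.sub_apply,
    sub_ne_zero, ne_eq]

/-- The NSED of every error event with difference word `e`. -/
def EventWord.cost (e : EventWord G) : ℕ := pathCost G 0 (extend e.2.1) e.1

/-- The number of bit errors of every error event with difference word `e`. -/
def EventWord.errors (e : EventWord G) : ℕ := bitErrors e.2.1 0

lemma EventWord.errors_le (e : EventWord G) : e.errors ≤ p * e.1 := bitErrors_le _ _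

/-- The difference word of an error event. -/
def ErrorEvent.eventWord (E : ErrorEvent G) : EventWord G :=
  ⟨E.len, E.sent - E.decoded,
    (isEvent_sub_iff E.start _ _).2 ⟨E.len_pos, E.diverge, E.unmerged, E.merge⟩⟩

/-- The error event with difference word `e`, start state `σ` and transmitted word `u`. -/
def EventWord.errorEvent (e : EventWord G) (σ : JState G) (u : Msg p e.1) : ErrorEvent G :=
  have h := (isEvent_sub_iff σ u (u - e.2.1)).1 (by rw [sub_sub_cancel]; exact e.2.2)
  ⟨σ, e.1, u, u - e.2.1, h.1, h.2.1, h.2.2.1, h.2.2.2⟩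

lemma EventWord.eventWord_errorEvent (e : EventWord G) (σ : JState G) (u : Msg p e.1) :
    (e.errorEvent σ u).eventWord = e :=
  Sigma.ext rfl (heq_of_eq (Subtype.ext (sub_sub_cancel u e.2.1)))

lemma ErrorEvent.errorEvent_eventWord (E : ErrorEvent G) :
    E.eventWord.errorEvent E.start E.sent = E := by
  obtain ⟨σ, L, u, v, _, _, _, _⟩ := E
  exact (ErrorEvent.mk.injEq ..).mpr ⟨rfl, rfl, HEq.rfl, heq_of_eq (sub_sub_cancel u v)⟩

lemma ErrorEvent.errors_eventWord (E : ErrorEvent G) :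
    E.eventWord.errors = bitErrors E.sent E.decoded :=
  (bitErrors_eq_bitErrors_sub_zero _ _).symm

lemma ErrorEvent.nsed_eq_cost_eventWord (E : ErrorEvent G) {K : ℕ} (hK : Odd K) {T : ℝ}
    (hT : 0 < T) : E.nsed K T = E.eventWord.cost :=
  E.nsed_eq_pathCost hK hT

/-- By linearity, an error event with given start state is determined by its difference word and its
transmitted word, which can be chosen independently. -/
def errorEventEquiv (G : Gen p s) (σ : JState G) :
    {E : ErrorEvent G // E.start = σ} ≃ Σ e : EventWord G, Msg p e.1 where
  toFun E := ⟨E.1.eventWord, E.1.sent⟩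
  invFun x := ⟨x.1.errorEvent σ x.2, rfl⟩
  left_inv := by
    rintro ⟨E, rfl⟩
    exact Subtype.ext E.errorEvent_eventWord
  right_inv x := Sigma.ext (x.1.eventWord_errorEvent σ x.2) HEq.rfl

lemma ErrorEvent.existsUnique_startsAt (E : ErrorEvent G) : ∃! j, E.StartsAt j := by
  obtain ⟨j, hj, hmin⟩ := wellFounded_lt.has_min {j | extend E.sent 0 j ≠ extend E.decoded 0 j}
    (Function.ne_iff.1 E.diverge)
  refine ⟨j, ⟨fun k hk => not_not.1 fun h => hmin k h hk, hj⟩, fun k hk => ?_⟩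
  rcases lt_trichotomy k j with h | h | h
  exacts [absurd h (hmin k hk.2), h, absurd (hk.1 j h) hj]

/-- The time of the first wrong bit of an error event. -/
def ErrorEvent.startTime (E : ErrorEvent G) : Fin p := E.existsUnique_startsAt.choose

lemma ErrorEvent.startTime_eq_iff (E : ErrorEvent G) {j : Fin p} :
    E.startTime = j ↔ E.StartsAt j := by
  have h := E.existsUnique_startsAt.choose_spec
  exact ⟨fun hj => hj ▸ h.1, fun hj => (h.2 j hj).symm⟩

/-- The quantities by which the transfer function sorts the error events. -/
def ErrorEvent.label (K : ℕ) (T : ℝ) (E : ErrorEvent G) : Fin p × ℕ × ℕ × ℝ :=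
  (E.startTime, p * E.len, bitErrors E.sent E.decoded, E.nsed K T)

lemma eventCount_eq_natCard_fiber (K : ℕ) (T : ℝ) (j : Fin p) (σ : JState G) (x : ℕ × ℕ × ℝ) :
    eventCount G K T j σ x.1 x.2.1 x.2.2 =
      Nat.card {E : {E : ErrorEvent G // E.start = σ} // E.1.label K T = (j, x)} := by
  refine Nat.card_congr (((Equiv.subtypeSubtypeEquivSubtypeInter
    (fun E : ErrorEvent G => E.start = σ) fun E => E.label K T = (j, x)).trans
    (Equiv.subtypeEquivRight fun E => ?_)).symm)
  obtain ⟨ι, τ, D⟩ := x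
  simp only [ErrorEvent.label, Prod.mk.injEq, E.startTime_eq_iff]
  tauto

lemma finite_label_fiber (hp : 0 < p) (K : ℕ) (T : ℝ) (σ : JState G) (x : Fin p × ℕ × ℕ × ℝ) :
    Finite {E : {E : ErrorEvent G // E.start = σ} // E.1.label K T = x} := by
  have hlen (E : {E : {E : ErrorEvent G // E.start = σ} // E.1.label K T = x}) :
      E.1.1.len < x.2.1 + 1 := by
    obtain ⟨E, rfl⟩ := E
    exact Nat.lt_succ_of_le (Nat.le_mul_of_pos_left _ hp)
  refine Finite.of_injective (β := Σ L : Fin (x.2.1 + 1), Msg p L × Msg p L)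
    (fun E => ⟨⟨E.1.1.len, hlen E⟩, E.1.1.sent, E.1.1.decoded⟩) ?_
  rintro ⟨⟨⟨start, len, sent, decoded, _, _, _, _⟩, hstart⟩, _⟩
    ⟨⟨⟨start', len', sent', decoded', _, _, _, _⟩, hstart'⟩, _⟩ h
  simp only [Sigma.mk.injEq, Fin.mk.injEq] at h
  obtain ⟨rfl, h⟩ := h
  obtain ⟨rfl, rfl⟩ := Prod.mk.injEq .. ▸ eq_of_heq h
  obtain rfl : start = start' := hstart.trans hstart'.symm
  rfl

/-- The factor `(1 / 2) ^ (p * L)` cancels the number of transmitted words of length `L`. -/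
lemma sum_ofReal_half_pow_mul (L : ℕ) (x : ℝ) :
    ∑ _ : Msg p L, ENNReal.ofReal ((1 / 2) ^ (p * L) * x) = ENNReal.ofReal x := by
  rw [Finset.sum_const, Finset.card_univ, card_msg, nsmul_eq_mul, ← ENNReal.ofReal_natCast,
    ← ENNReal.ofReal_mul (Nat.cast_nonneg _), ← mul_assoc]
  push_cast
  rw [← mul_pow, mul_one_div_cancel two_ne_zero, one_pow, one_mul]

lemma sum_tsum_ofReal_transferTerm (hp : 0 < p) {K : ℕ} (hK : Odd K) {T : ℝ} (hT : 0 < T)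
    (σ : JState G) (ε ζ : ℝ) :
    ∑ j, ∑' x, ENNReal.ofReal (transferTerm G K T j σ (1 / 2) ε ζ x) =
      ∑' e : EventWord G, ENNReal.ofReal (ε ^ e.errors * ζ ^ e.cost) := by
  set f : Fin p × ℕ × ℕ × ℝ → ENNReal := fun x =>
    ENNReal.ofReal ((1 / 2) ^ x.2.1 * (ε ^ x.2.2.1 * ζ ^ x.2.2.2))
  have hterm (j : Fin p) (x : ℕ × ℕ × ℝ) :
      ENNReal.ofReal (transferTerm G K T j σ (1 / 2) ε ζ x) =
        Nat.card {E : {E : ErrorEvent G // E.start = σ} // E.1.label K T = (j, x)} * f (j, x) := by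
    rw [transferTerm, eventCount_eq_natCard_fiber, mul_assoc, mul_assoc,
      ENNReal.ofReal_mul (Nat.cast_nonneg _), ENNReal.ofReal_natCast]
  have hlabel (E : ErrorEvent G) : f (E.label K T) = ENNReal.ofReal
      ((1 / 2) ^ (p * E.len) * (ε ^ E.eventWord.errors * ζ ^ E.eventWord.cost)) := by
    simp only [f, ErrorEvent.label, E.nsed_eq_cost_eventWord hK hT, Real.rpow_natCast,
      E.errors_eventWord]
  calc ∑ j, ∑' x, ENNReal.ofReal (transferTerm G K T j σ (1 / 2) ε ζ x)
      = ∑' x, Nat.card {E : {E : ErrorEvent G // E.start = σ} // E.1.label K T = x} * f x := by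
        rw [ENNReal.tsum_prod', tsum_fintype]
        simp only [hterm]
    _ = ∑' E : {E : ErrorEvent G // E.start = σ}, f (E.1.label K T) :=
        tsum_natCard_fiber_mul (fun E : {E : ErrorEvent G // E.start = σ} => E.1.label K T)
          (finite_label_fiber hp K T σ) f
    _ = ∑' (e : EventWord G) (u : Msg p e.1), f ((e.errorEvent σ u).label K T) := by
        rw [← (errorEventEquiv G σ).symm.tsum_eq, ENNReal.tsum_sigma']
        rfl
    _ = ∑' e : EventWord G, ENNReal.ofReal (ε ^ e.errors * ζ ^ e.cost) := by
        refine tsum_congr fun e => ?_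
        simp only [hlabel, e.eventWord_errorEvent]
        rw [tsum_fintype]
        exact sum_ofReal_half_pow_mul e.1 _

lemma transferTerm_nonneg (G : Gen p s) (K : ℕ) (T : ℝ) (j : Fin p) (σ : JState G) {η ε ζ : ℝ}
    (hη : 0 ≤ η) (hε : 0 ≤ ε) (hζ : 0 ≤ ζ) (x : ℕ × ℕ × ℝ) :
    0 ≤ transferTerm G K T j σ η ε ζ x := by
  unfold transferTerm
  positivity

lemma transferFunction_eq (hp : 0 < p) {K : ℕ} (hK : Odd K) {T : ℝ} (hT : 0 < T) {ε ζ : ℝ}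
    (hε : 0 ≤ ε) (hζ : 0 ≤ ζ) (h : Summable fun e : EventWord G => ε ^ e.errors * ζ ^ e.cost) :
    transferFunction G K T (1 / 2) ε ζ = 1 / p * ∑' e : EventWord G, ε ^ e.errors * ζ ^ e.cost := by
  have hsum (σ : JState G) : ∑ j, ∑' x, transferTerm G K T j σ (1 / 2) ε ζ x =
      ∑' e : EventWord G, ε ^ e.errors * ζ ^ e.cost := by
    have htop := sum_tsum_ofReal_transferTerm hp hK hT σ ε ζ
    have hne := h.tsum_ofReal_ne_top
    rw [← htop, ENNReal.sum_ne_top] at hne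
    replace htop := congrArg ENNReal.toReal htop
    rw [ENNReal.toReal_sum hne, ENNReal.tsum_toReal_eq fun _ => ENNReal.ofReal_ne_top] at htop
    simpa only [ENNReal.tsum_toReal_eq fun _ => ENNReal.ofReal_ne_top,
      ENNReal.toReal_ofReal (transferTerm_nonneg G K T _ σ one_half_pos.le hε hζ _),
      ENNReal.toReal_ofReal (mul_nonneg (pow_nonneg hε _) (pow_nonneg hζ _))] using htop
  rw [transferFunction, Finset.sum_comm, Finset.sum_congr rfl fun σ _ => hsum σ, Finset.sum_const,
    Finset.card_univ, card_jState, nsmul_eq_mul]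
  push_cast
  field_simp

lemma summable_pow_cost (hp : 0 < p) {K : ℕ} (hK : Odd K) {T : ℝ} (hT : 0 < T) {ζ : ℝ} (hζ : 0 ≤ ζ)
    (hF : ∀ (j : Fin p) (σ : JState G), Summable (transferTerm G K T j σ (1 / 2) 1 ζ)) :
    Summable fun e : EventWord G => ζ ^ e.cost := by
  have h : ∑ j, ∑' x, ENNReal.ofReal (transferTerm G K T j 0 (1 / 2) 1 ζ x) ≠ ⊤ :=
    ENNReal.sum_ne_top.2 fun j _ => (hF j 0).tsum_ofReal_ne_top
  rw [sum_tsum_ofReal_transferTerm hp hK hT] at h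
  refine (ENNReal.summable_toReal h).congr fun e => ?_
  rw [one_pow, one_mul, ENNReal.toReal_ofReal (by positivity)]

end TransferFunction

/-! ### Differentiation of the transfer function -/

section GeneratingFunction

lemma exists_abs_natCast_mul_pow_le {r : ℝ} (hr : 1 < r) :
    ∃ q C : ℝ, 1 < q ∧ ∀ y, |y| ≤ q → ∀ n : ℕ, |n * y ^ (n - 1)| ≤ C * r ^ n := by
  have hq : 1 < √r := Real.lt_sqrt_of_sq_lt (by rwa [one_pow])
  refine ⟨√r, 1 / (√r - 1), hq, fun y hy n => ?_⟩
  have hn : (n : ℝ) ≤ 1 / (√r - 1) * √r ^ n := by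
    rw [one_div_mul_eq_div, le_div_iff₀ (sub_pos.2 hq)]
    linarith [one_add_mul_sub_le_pow (n := n) (show -1 ≤ √r by linarith)]
  calc |n * y ^ (n - 1)| = n * |y| ^ (n - 1) := by rw [abs_mul, Nat.abs_cast, abs_pow]
    _ ≤ n * √r ^ n := by
        gcongr ?_ * ?_
        exact (pow_le_pow_left₀ (abs_nonneg y) hy _).trans
          (pow_le_pow_right₀ hq.le (Nat.sub_le n 1))
    _ ≤ 1 / (√r - 1) * √r ^ n * √r ^ n := by gcongr
    _ = 1 / (√r - 1) * r ^ n := by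
        rw [mul_assoc, ← mul_pow, Real.mul_self_sqrt (zero_le_one.trans hr.le)]

variable {ι : Type*} {n : ι → ℕ} {a : ι → ℝ} {r : ℝ}

lemma summable_natCast_mul (ha : ∀ i, 0 ≤ a i) (hr : 1 < r)
    (h : Summable fun i => r ^ n i * a i) : Summable fun i => n i * a i := by
  obtain ⟨q, C, hq, hC⟩ := exists_abs_natCast_mul_pow_le hr
  refine Summable.of_nonneg_of_le (fun i => mul_nonneg (Nat.cast_nonneg _) (ha i)) (fun i => ?_)
    (h.mul_left C)
  have hn := hC 1 (by rw [abs_one]; exact hq.le) (n i)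
  rw [one_pow, mul_one, Nat.abs_cast] at hn
  rw [← mul_assoc]
  exact mul_le_mul_of_nonneg_right hn (ha i)

lemma hasDerivAt_tsum_pow_mul (ha : ∀ i, 0 ≤ a i) (hr : 1 < r)
    (h : Summable fun i => r ^ n i * a i) :
    HasDerivAt (fun ε => ∑' i, ε ^ n i * a i) (∑' i, n i * a i) 1 := by
  obtain ⟨q, C, hq, hC⟩ := exists_abs_natCast_mul_pow_le hr
  have hmem : (1 : ℝ) ∈ Set.Ioo (-q) q := ⟨by linarith, hq⟩
  have hone : Summable fun i => (1 : ℝ) ^ n i * a i :=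
    Summable.of_nonneg_of_le (fun i => mul_nonneg (by positivity) (ha i))
      (fun i => mul_le_mul_of_nonneg_right (pow_le_pow_left₀ zero_le_one hr.le _) (ha i)) h
  have hbound (i : ι) (y : ℝ) (hy : y ∈ Set.Ioo (-q) q) :
      ‖n i * y ^ (n i - 1) * a i‖ ≤ C * (r ^ n i * a i) := by
    rw [norm_mul, Real.norm_of_nonneg (ha i), ← mul_assoc]
    exact mul_le_mul_of_nonneg_right (hC y (abs_le.2 ⟨hy.1.le, hy.2.le⟩) (n i)) (ha i)
  simpa only [one_pow, mul_one] using hasDerivAt_tsum_of_isPreconnected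
    (g := fun i ε => ε ^ n i * a i) (g' := fun i ε => n i * ε ^ (n i - 1) * a i) (h.mul_left C)
    isOpen_Ioo isPreconnected_Ioo (fun i y _ => (hasDerivAt_pow (n i) y).mul_const (a i)) hbound
    hmem hone hmem

end GeneratingFunction

section TransferFunction

variable {p s : ℕ} [NeZero s] {G : Gen p s}

open scoped ENNReal in
lemma sum_ite_pow_le_toReal {ι : Type*} [Fintype ι] (A : ι → Prop) [DecidablePred A] (c : ι → ℕ)
    {ζ : ℝ} (hζ : 0 ≤ ζ) {B : ℝ≥0∞} (hB : B ≠ ∞)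
    (h : ∑ i, (if A i then ENNReal.ofReal ζ ^ c i else 0) ≤ B) :
    ∑ i, (if A i then ζ ^ c i else 0) ≤ B.toReal := by
  rw [← ENNReal.ofReal_le_iff_le_toReal hB, ENNReal.ofReal_sum_of_nonneg fun i _ => by
    split_ifs <;> positivity]
  simpa only [apply_ite ENNReal.ofReal, ENNReal.ofReal_pow hζ, ENNReal.ofReal_zero] using h

theorem exists_sum_weight_le_real {ζ : ℝ} (hζ : 0 < ζ)
    (h : Summable fun e : EventWord G => ζ ^ e.cost) :
    ∃ ρ C : ℝ, 0 ≤ ρ ∧ ρ < 1 ∧ 0 ≤ C ∧ ∀ n,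
      (∑ w : Msg p n, open Classical in
        if Avoids G 0 (extend w) (n + 1) then ζ ^ pathCost G 0 (extend w) n else 0) ≤ C * ρ ^ n ∧
      (∑ w : Msg p (n + 1), open Classical in
        if IsEvent G w then ζ ^ pathCost G 0 (extend w) (n + 1) else 0) ≤ C * ρ ^ n := by
  have htsum : ∑' e : EventWord G, ENNReal.ofReal ζ ^ e.cost ≠ ⊤ := by
    simpa only [ENNReal.ofReal_pow hζ.le] using h.tsum_ofReal_ne_top
  obtain ⟨ρ, C, hρ, hC, hdecay⟩ := exists_sum_weight_le (by simpa using hζ)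
    ENNReal.ofReal_ne_top htsum
  have hρtop : ρ ≠ ⊤ := (hρ.trans ENNReal.one_lt_top).ne
  refine ⟨ρ.toReal, C.toReal, ENNReal.toReal_nonneg,
    (ENNReal.toReal_lt_toReal hρtop ENNReal.one_ne_top).2 hρ, ENNReal.toReal_nonneg, fun n => ?_⟩
  have htop : C * ρ ^ n ≠ ⊤ := ENNReal.mul_ne_top hC (ENNReal.pow_ne_top hρtop)
  rw [← ENNReal.toReal_pow, ← ENNReal.toReal_mul]
  classical
  exact ⟨sum_ite_pow_le_toReal _ _ hζ.le htop (hdecay n).1,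
    sum_ite_pow_le_toReal _ _ hζ.le htop (hdecay n).2⟩

open Classical in
lemma sum_msg_ite_isEvent {M : Type*} [AddCommMonoid M] {L : ℕ} (f : Msg p L → M) :
    ∑ w : {w : Msg p L // IsEvent G w}, f w.1 = ∑ w, if IsEvent G w then f w else 0 := by
  rw [← Finset.sum_filter]
  exact (Finset.sum_subtype _ (by simp) f).symm

/-- The generating function of the number of bit errors converges beyond `1`, since long error
events have exponentially small weight. -/
lemma exists_summable_pow_errors_mul {ζ : ℝ} (hζ : 0 < ζ)
    (h : Summable fun e : EventWord G => ζ ^ e.cost) :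
    ∃ r : ℝ, 1 < r ∧ Summable fun e : EventWord G => r ^ e.errors * ζ ^ e.cost := by
  classical
  obtain ⟨ρ, C, hρ0, hρ1, _, hdecay⟩ := exists_sum_weight_le_real hζ h
  obtain ⟨r, hrρ, hr⟩ : ∃ r : ℝ, r ^ p * ρ < 1 ∧ 1 < r := by
    have hlim : ContinuousAt (fun r : ℝ => r ^ p * ρ) 1 := by fun_prop
    have hlt : (1 : ℝ) ^ p * ρ < 1 := by rwa [one_pow, one_mul]
    exact ((hlim.continuousWithinAt.eventually_lt_const hlt).and
      (self_mem_nhdsWithin (s := Set.Ioi 1))).exists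
  have := one_pos.trans hr
  refine ⟨r, hr, Summable.of_nonneg_of_le (fun e => by positivity)
    (fun e => mul_le_mul_of_nonneg_right (pow_le_pow_right₀ hr.le e.errors_le) (by positivity)) ?_⟩
  rw [summable_sigma_of_nonneg fun e => by positivity]
  refine ⟨fun L => (hasSum_fintype _).summable, (summable_nat_add_iff 1).1 ?_⟩
  have hgeom : Summable fun L : ℕ => r ^ p * C * (r ^ p * ρ) ^ L :=
    (summable_geometric_of_lt_one (by positivity) hrρ).mul_left _
  refine Summable.of_nonneg_of_le (fun L => tsum_nonneg fun w => by positivity) (fun L => ?_) hgeom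
  calc ∑' w : {w : Msg p (L + 1) // IsEvent G w},
        r ^ (p * (L + 1)) * ζ ^ pathCost G 0 (extend w.1) (L + 1)
      = r ^ (p * (L + 1)) * ∑ w : Msg p (L + 1),
        if IsEvent G w then ζ ^ pathCost G 0 (extend w) (L + 1) else 0 := by
        rw [tsum_fintype, ← Finset.mul_sum, ← sum_msg_ite_isEvent]
    _ ≤ r ^ (p * (L + 1)) * (C * ρ ^ L) := by
        gcongr
        exact (hdecay L).2
    _ = r ^ p * C * (r ^ p * ρ) ^ L := by ring

lemma summable_errors_mul {ζ : ℝ} (hζ : 0 < ζ)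
    (h : Summable fun e : EventWord G => ζ ^ e.cost) :
    Summable fun e : EventWord G => e.errors * ζ ^ e.cost := by
  obtain ⟨r, hr, hsum⟩ := exists_summable_pow_errors_mul hζ h
  exact summable_natCast_mul (fun e => by positivity) hr hsum

theorem hasDerivAt_transferFunction (hp : 0 < p) {K : ℕ} (hK : Odd K) {T : ℝ} (hT : 0 < T) {ζ : ℝ}
    (hζ : 0 < ζ) (h : Summable fun e : EventWord G => ζ ^ e.cost) :
    HasDerivAt (fun ε => transferFunction G K T (1 / 2) ε ζ)
      (1 / p * ∑' e : EventWord G, e.errors * ζ ^ e.cost) 1 := by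
  obtain ⟨r, hr, hsum⟩ := exists_summable_pow_errors_mul hζ h
  refine ((hasDerivAt_tsum_pow_mul (fun e => by positivity) hr hsum).const_mul
    _).congr_of_eventuallyEq ?_
  filter_upwards [Ioo_mem_nhds one_pos hr] with ε hε
  have hε0 : 0 ≤ ε := hε.1.le
  refine transferFunction_eq hp hK hT hε0 hζ.le
    (Summable.of_nonneg_of_le (fun e => by positivity) (fun e => ?_) hsum)
  gcongr
  exact hε.2.le

end TransferFunction

/-! ### Segmentation of a difference stream into error events -/

section Segments

variable {p s : ℕ}

/-- The word of length `L` at time `a` in an input stream. -/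
def window (d : ℕ → Inp p) (a L : ℕ) : Msg p L := fun i => d (a + i)

lemma extend_window (d : ℕ → Inp p) (a : ℕ) {L t : ℕ} (h : t < L) :
    extend (window d a L) t = d (a + t) := extend_of_lt _ h

lemma bitErrors_zero {L : ℕ} (w : Msg p L) : bitErrors w 0 = ∑ t, hammingNorm (w t) := by
  simp only [bitErrors, hammingNorm, Finset.card_filter, Fintype.sum_prod_type, Pi.zero_apply]

lemma bitErrors_window_zero (d : ℕ → Inp p) (a L : ℕ) :
    bitErrors (window d a L) 0 = ∑ t ∈ Finset.Ico a (a + L), hammingNorm (d t) := by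
  rw [bitErrors_zero, Finset.sum_Ico_eq_sum_range, Nat.add_sub_cancel_left]
  exact Fin.sum_univ_eq_sum_range (fun t => hammingNorm (d (a + t))) L

lemma window_extend {N : ℕ} (u : Msg p N) : window (extend u) 0 N = u := by
  funext t
  rw [window, zero_add, extend_of_lt u t.2]

lemma sum_le_sum_sum_of_cover {ι κ : Type*} {A : Finset κ} {S : Finset ι} {I : ι → Finset κ}
    {f : κ → ℕ} (h : ∀ t ∈ A, f t ≠ 0 → ∃ x ∈ S, t ∈ I x) :
    ∑ t ∈ A, f t ≤ ∑ x ∈ S, ∑ t ∈ I x, f t := by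
  classical
  calc ∑ t ∈ A, f t
      ≤ ∑ t ∈ A, ∑ x ∈ S with t ∈ I x, f t := by
        refine Finset.sum_le_sum fun t ht => ?_
        obtain h0 | h0 := eq_or_ne (f t) 0
        · exact h0.trans_le (Nat.zero_le _)
        · obtain ⟨x, hx, htx⟩ := h t ht h0
          exact Finset.single_le_sum (f := fun _ => f t) (fun _ _ => Nat.zero_le _)
            (Finset.mem_filter.2 ⟨hx, htx⟩)
    _ = ∑ x ∈ S, ∑ t ∈ A with t ∈ I x, f t :=
        Finset.sum_comm' fun t x => by simp only [Finset.mem_filter]; tauto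
    _ ≤ ∑ x ∈ S, ∑ t ∈ I x, f t :=
        Finset.sum_le_sum fun x _ => Finset.sum_le_sum_of_subset fun t ht =>
          (Finset.mem_filter.1 ht).2

variable [NeZero s] {G : Gen p s}

/-- In a block of `N` steps, the word `w` at time `a` is a complete error event, or one that the end
of the block leaves unterminated. -/
def IsSegment (G : Gen p s) (N a : ℕ) {L : ℕ} (w : Msg p L) : Prop :=
  (a + L ≤ N ∧ IsEvent G w) ∨ (a + L = N ∧ Avoids G 0 (extend w) (L + 1))

lemma IsSegment.add_le {N a L : ℕ} {w : Msg p L} (h : IsSegment G N a w) : a + L ≤ N :=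
  h.elim (fun h => h.1) fun h => h.1.le

lemma diffStateAt_window {d : ℕ → Inp p} {a : ℕ} (ha : diffStateAt G 0 d a = 0) {L t : ℕ}
    (h : t ≤ L) : diffStateAt G 0 (extend (window d a L)) t = diffStateAt G 0 d (a + t) := by
  rw [diffStateAt_add, ha]
  exact diffStateAt_congr G 0 fun i hi => extend_window d a (hi.trans_le h)

lemma avoids_window {d : ℕ → Inp p} {a : ℕ} (ha : diffStateAt G 0 d a = 0) {L n : ℕ}
    (hn : n ≤ L + 1) (h : ∀ t, a < t → t < a + n → diffStateAt G 0 d t ≠ 0) :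
    Avoids G 0 (extend (window d a L)) n := fun t h0 htn => by
  rw [diffStateAt_window ha (by omega)]
  exact h _ (by omega) (by omega)

lemma isEvent_window {d : ℕ → Inp p} {a b : ℕ} (hab : a < b) (ha : diffStateAt G 0 d a = 0)
    (hda : d a ≠ 0) (hb : diffStateAt G 0 d b = 0)
    (h : ∀ t, a < t → t < b → diffStateAt G 0 d t ≠ 0) : IsEvent G (window d a (b - a)) := by
  refine ⟨Nat.sub_pos_of_lt hab, ?_, avoids_window ha (Nat.le_succ _) ?_, ?_⟩
  · rwa [extend_window d a (Nat.sub_pos_of_lt hab), add_zero]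
  · rwa [Nat.add_sub_cancel' hab.le]
  · rwa [diffStateAt_window ha le_rfl, Nat.add_sub_cancel' hab.le]

lemma exists_last_zero {d : ℕ → Inp p} {t : ℕ} (hd : d t ≠ 0) :
    ∃ a ≤ t, diffStateAt G 0 d a = 0 ∧ d a ≠ 0 ∧
      ∀ k, a < k → k ≤ t → diffStateAt G 0 d k ≠ 0 := by
  classical
  let a := Nat.findGreatest (fun a => diffStateAt G 0 d a = 0) t
  have hat : a ≤ t := Nat.findGreatest_le t
  have ha : diffStateAt G 0 d a = 0 :=
    Nat.findGreatest_spec (P := fun a => diffStateAt G 0 d a = 0) (Nat.zero_le t) rfl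
  have hlast (k : ℕ) (hak : a < k) (hkt : k ≤ t) : diffStateAt G 0 d k ≠ 0 :=
    Nat.findGreatest_is_greatest hak hkt
  refine ⟨a, hat, ha, fun h0 => ?_, hlast⟩
  have hsucc : diffStateAt G 0 d (a + 1) = 0 := by rw [diffStateAt, ha, h0, diffStep_zero]
  obtain h | h := hat.eq_or_lt
  · exact hd (h ▸ h0)
  · exact hlast (a + 1) a.lt_succ_self h hsucc

lemma exists_isSegment_window (G : Gen p s) (d : ℕ → Inp p) {N t : ℕ} (ht : t < N) (hd : d t ≠ 0) :
    ∃ a L, t ∈ Finset.Ico a (a + L) ∧ diffStateAt G 0 d a = 0 ∧ IsSegment G N a (window d a L) := by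
  classical
  obtain ⟨a, hat, ha, hda, hlast⟩ := exists_last_zero (G := G) hd
  by_cases hex : ∃ b, t < b ∧ b ≤ N ∧ diffStateAt G 0 d b = 0
  · obtain ⟨htb, hbN, hb⟩ := Nat.find_spec hex
    have hfirst (k : ℕ) (hak : a < k) (hkb : k < Nat.find hex) : diffStateAt G 0 d k ≠ 0 := by
      obtain h | h := le_or_gt k t
      · exact hlast k hak h
      · exact fun h0 => Nat.find_min hex hkb ⟨h, hkb.le.trans hbN, h0⟩
    exact ⟨a, Nat.find hex - a, Finset.mem_Ico.2 ⟨hat, by omega⟩, ha,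
      Or.inl ⟨by omega, isEvent_window (hat.trans_lt htb) ha hda hb hfirst⟩⟩
  · push Not at hex
    refine ⟨a, N - a, Finset.mem_Ico.2 ⟨hat, by omega⟩, ha,
      Or.inr ⟨by omega, avoids_window ha le_rfl fun k hak hk => ?_⟩⟩
    obtain h | h := le_or_gt k t
    · exact hlast k hak h
    · exact hex k h (by omega)

open Classical in
/-- The words `x.2` that are segments at time `x.1` of a block of `N` steps. -/
def segments (G : Gen p s) (N : ℕ) : Finset (ℕ × Σ L, Msg p L) :=
  {x ∈ Finset.range N ×ˢ (Finset.range (N + 1)).sigma fun _ => Finset.univ |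
    IsSegment G N x.1 x.2.2}

lemma isSegment_of_mem_segments {N : ℕ} {x : ℕ × Σ L, Msg p L} (hx : x ∈ segments G N) :
    IsSegment G N x.1 x.2.2 := by
  classical exact (Finset.mem_filter.1 hx).2

/-- The word `x.2` occurs in the stream `d` at time `x.1`, at which the difference state is zero. -/
def OccursIn (G : Gen p s) (d : ℕ → Inp p) (x : ℕ × Σ L, Msg p L) : Prop :=
  diffStateAt G 0 d x.1 = 0 ∧ x.2.2 = window d x.1 x.2.1

open Classical in
lemma bitErrors_le_sum_segments (G : Gen p s) {N : ℕ} (u v : Msg p N) :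
    bitErrors u v ≤
      ∑ x ∈ segments G N with OccursIn G (extend (u - v)) x, bitErrors x.2.2 0 := by
  set d := extend (u - v)
  calc bitErrors u v = ∑ t ∈ Finset.Ico 0 (0 + N), hammingNorm (d t) := by
        rw [← bitErrors_window_zero, window_extend, ← bitErrors_eq_bitErrors_sub_zero]
    _ ≤ ∑ x ∈ segments G N with OccursIn G d x,
          ∑ t ∈ Finset.Ico x.1 (x.1 + x.2.1), hammingNorm (d t) := by
        refine sum_le_sum_sum_of_cover fun t ht hdt => ?_
        have htN : t < N := by simpa using ht
        obtain ⟨a, L, hmem, ha, hseg⟩ :=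
          exists_isSegment_window G d htN (hammingNorm_ne_zero_iff.1 hdt)
        have hle := hseg.add_le
        have hIco := Finset.mem_Ico.1 hmem
        refine ⟨(a, ⟨L, window d a L⟩), ?_, hmem⟩
        simp only [segments, Finset.mem_filter, Finset.mem_product, Finset.mem_sigma,
          Finset.mem_range, Finset.mem_univ, and_true]
        exact ⟨⟨⟨by omega, by omega⟩, hseg⟩, ha, rfl⟩
    _ = ∑ x ∈ segments G N with OccursIn G d x, bitErrors x.2.2 0 := by
        refine Finset.sum_congr rfl fun x hx => ?_
        rw [(Finset.mem_filter.1 hx).2.2, bitErrors_window_zero]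

/-! ### Exchanging one segment -/

/-- The block of `N` steps that has the word `w` at time `a` and is zero elsewhere. -/
def placedBlock (N a : ℕ) {L : ℕ} (w : Msg p L) : Msg p N := fun t => delay a (extend w) t

omit [NeZero s] in
lemma extend_placedBlock {N a L : ℕ} (h : a + L ≤ N) (w : Msg p L) :
    extend (placedBlock N a w) = delay a (extend w) := by
  funext t
  obtain ht | ht := lt_or_ge t N
  · exact extend_of_lt _ ht
  · rw [extend_of_le _ ht, delay, if_neg (by omega), extend_of_le w (by omega)]

lemma diffStateAt_eq_zero_of_le {u : ℕ → Inp p} {L t : ℕ} (hL : diffStateAt G 0 u L = 0)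
    (hu : ∀ n, L ≤ n → u n = 0) (h : L ≤ t) : diffStateAt G 0 u t = 0 := by
  obtain ⟨r, rfl⟩ := Nat.exists_eq_add_of_le h
  rw [diffStateAt_add, hL, diffStateAt_congr G 0 (v := 0) fun i _ => hu _ (Nat.le_add_right L i),
    diffStateAt_zero_zero]

lemma pathCost_eq_of_le {u : ℕ → Inp p} {L t : ℕ} (hL : diffStateAt G 0 u L = 0)
    (hu : ∀ n, L ≤ n → u n = 0) (h : L ≤ t) : pathCost G 0 u t = pathCost G 0 u L := by
  obtain ⟨r, rfl⟩ := Nat.exists_eq_add_of_le h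
  rw [pathCost_add, hL, pathCost_congr G 0 (v := 0) fun i _ => hu _ (Nat.le_add_right L i),
    pathCost_zero_zero, add_zero]

lemma pathCost_delay_add (G : Gen p s) (u : ℕ → Inp p) (a t : ℕ) :
    pathCost G 0 (delay a u) (a + t) = pathCost G 0 u t := by
  rw [pathCost_add, diffStateAt_delay_of_le G u le_rfl, delay_add,
    pathCost_congr G 0 (u := delay a u) (v := 0) fun i hi => if_pos hi, pathCost_zero_zero,
    zero_add]

lemma IsSegment.pathCost_delay {N a L : ℕ} {w : Msg p L} (h : IsSegment G N a w) :
    pathCost G 0 (delay a (extend w)) N = pathCost G 0 (extend w) L := by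
  rw [← Nat.add_sub_cancel' ((Nat.le_add_right a L).trans h.add_le), pathCost_delay_add]
  obtain ⟨haL, _, _, hhits⟩ | ⟨haL, _⟩ := h
  · exact pathCost_eq_of_le hhits.2 (fun _ => extend_of_le w) (by omega)
  · rw [← haL, Nat.add_sub_cancel_left]

lemma IsSegment.pathCost_sub_placedBlock {N a L : ℕ} {w : Msg p L} (h : IsSegment G N a w)
    (u : Msg p N) :
    pathCost G 0 (extend (u - placedBlock N a w) - extend u) N = pathCost G 0 (extend w) L := by
  rw [extend_sub, extend_placedBlock h.add_le, ← h.pathCost_delay]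
  congr 1
  funext t i
  simp [ZModModule.neg_eq_self]

lemma IsSegment.delay_eq_zero {N a L n : ℕ} {w : Msg p L} (h : IsSegment G N a w) (hn : n < N)
    (hout : n < a ∨ a + L ≤ n) :
    diffStateAt G 0 (delay a (extend w)) n = 0 ∧ delay a (extend w) n = 0 := by
  obtain hna | han := hout
  · exact ⟨diffStateAt_delay_of_le G _ hna.le, if_pos hna⟩
  · obtain ⟨r, rfl⟩ := Nat.exists_eq_add_of_le ((Nat.le_add_right a L).trans han)
    have hLr : L ≤ r := Nat.le_of_add_le_add_left han
    rw [diffStateAt_delay_add, congrFun (delay_add a (extend w)) r]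
    obtain ⟨_, _, _, hhits⟩ | ⟨haL, _⟩ := h
    · exact ⟨diffStateAt_eq_zero_of_le hhits.2 (fun _ => extend_of_le w) hLr, extend_of_le w hLr⟩
    · omega

lemma sub_delay_window_eq_zero {d : ℕ → Inp p} {a L n : ℕ} (ha : diffStateAt G 0 d a = 0)
    (hin : a ≤ n ∧ n < a + L) :
    diffStateAt G 0 (d - delay a (extend (window d a L))) n = 0 ∧
      (d - delay a (extend (window d a L))) n = 0 := by
  obtain ⟨r, rfl⟩ := Nat.exists_eq_add_of_le hin.1
  have hr : r < L := Nat.lt_of_add_lt_add_left hin.2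
  have hstate := diffStateAt_sub G 0 0 d (delay a (extend (window d a L))) (a + r)
  rw [sub_zero] at hstate
  rw [hstate, diffStateAt_delay_add, diffStateAt_window ha hr.le, sub_self, Pi.sub_apply,
    congrFun (delay_add a (extend (window d a L))) r, extend_window d a hr, sub_self]
  exact ⟨rfl, rfl⟩

lemma symbol_eq_zero {f : ℕ → Inp p} {n : ℕ} (hstate : diffStateAt G 0 f (n / s) = 0)
    (hf : f (n / s) = 0) : symbol G 0 f n = 0 ∧ rscState (symbol G 0 f) n = 0 := by
  have hbits : stepBits G 0 0 = 0 := by simpa using stepBits_sub G 0 0 0 0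
  have hrsc (k : ℕ) : rscState 0 k = 0 := by simpa using rscState_sub 0 0 k
  have hn : n / s * s + n % s = n := by rw [mul_comm, Nat.div_add_mod]
  have hk : n % s < s := Nat.mod_lt _ (NeZero.pos s)
  have h := (diffStateAt_eq_stateAt G 0 f (n / s)).symm.trans hstate
  rw [Prod.mk_eq_zero] at h
  rw [← hn, symbol_block G 0 f _ hk, rscState_symbol_block G 0 f _ hk.le, h.1, h.2, hf, hbits, hrsc,
    add_zero]
  exact ⟨rfl, rfl⟩

lemma envelope_eq_of_sub_eq (K : ℕ) {T t : ℝ} {x y f : ℕ → Inp p} (hf : x - y = f)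
    (h : diffStateAt G 0 f (⌊t / T⌋₊ / s) = 0 ∧ f (⌊t / T⌋₊ / s) = 0) :
    envelope G K T 0 x t = envelope G K T 0 y t := by
  obtain ⟨hsymbol, hrsc⟩ := symbol_eq_zero h.1 h.2
  have hsub := symbol_sub G 0 0 x y
  rw [hf, sub_zero] at hsub
  rw [hsub, Pi.sub_apply, sub_eq_zero] at hsymbol
  rw [hsub, rscState_sub, sub_eq_zero] at hrsc
  simp only [envelope, phase, hsymbol, hrsc]

lemma envelope_exchange (K : ℕ) {T t : ℝ} {N a L : ℕ} {x y e : ℕ → Inp p} {w : Msg p L}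
    (he : e = delay a (extend w)) (hw : IsSegment G N a w) (ht : ⌊t / T⌋₊ / s < N)
    (hocc : OccursIn G (x - y) (a, ⟨L, w⟩)) :
    envelope G K T 0 y t - envelope G K T 0 (y + e) t =
      envelope G K T 0 (x - e) t - envelope G K T 0 x t := by
  by_cases hin : a ≤ ⌊t / T⌋₊ / s ∧ ⌊t / T⌋₊ / s < a + L
  · have hzero := sub_delay_window_eq_zero hocc.1 hin
    rw [← hocc.2, ← he] at hzero
    rw [envelope_eq_of_sub_eq K (x := x) (y := y + e) (by abel) hzero,
      envelope_eq_of_sub_eq K (x := x - e) (y := y) (by abel) hzero]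
  · have hzero := hw.delay_eq_zero ht (by omega)
    rw [← he] at hzero
    rw [envelope_eq_of_sub_eq K (x := y + e) (y := y) (by abel) hzero,
      envelope_eq_of_sub_eq K (x := x) (y := x - e) (by abel) hzero, sub_self, sub_self]

lemma floor_div_div_lt {T t : ℝ} (hT : 0 < T) {N : ℕ} (ht : t ∈ Set.Ico 0 (N * s * T)) :
    ⌊t / T⌋₊ / s < N := by
  rw [Nat.div_lt_iff_lt_mul (NeZero.pos s), Nat.floor_lt (div_nonneg ht.1 hT.le), div_lt_iff₀ hT]
  exact_mod_cast ht.2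

omit [NeZero s] in
lemma extend_add {L : ℕ} (u v : Msg p L) : extend (u + v) = extend u + extend v := by
  rw [← sub_eq_iff_eq_add, ← extend_sub, add_sub_cancel_right]

lemma signal_exchange (K : ℕ) {T : ℝ} (hT : 0 < T) (Es : ℝ) {N : ℕ} {u v : Msg p N}
    {a L : ℕ} {w : Msg p L} (hw : IsSegment G N a w)
    (hocc : OccursIn G (extend (u - v)) (a, ⟨L, w⟩)) :
    signal G K T Es v - signal G K T Es (v + placedBlock N a w) =
      signal G K T Es (u - placedBlock N a w) - signal G K T Es u := by
  funext t
  by_cases ht : t ∈ Set.Ico 0 (N * s * T)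
  · rw [extend_sub] at hocc
    simp only [Pi.sub_apply, signal, Set.indicator_of_mem ht, ← mul_sub, extend_add, extend_sub]
    rw [envelope_exchange K (extend_placedBlock hw.add_le w) hw (floor_div_div_lt hT ht) hocc]
  · simp only [Pi.sub_apply, signal, Set.indicator_of_notMem ht, sub_self]

end Segments

/-! ### The union bound -/

section UnionBound

variable {p s : ℕ} [NeZero s] {G : Gen p s}

lemma exp_neg_half_pow (c : ℝ) (n : ℕ) : Real.exp (-(c / 2)) ^ n = Real.exp (-(n * c / 2)) := by
  rw [← Real.exp_nat_mul]
  congr 1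
  ring

lemma gaussQ_sqrt_natCast_mul_le_pow {c : ℝ} (hc : 0 ≤ c) (n : ℕ) :
    gaussQ √(n * c) ≤ Real.exp (-(c / 2)) ^ n :=
  exp_neg_half_pow c n ▸ gaussQ_sqrt_le_exp (by positivity)

lemma symbol_eq_zero_of_pathCost_eq_zero {σ : JState G} {u : ℕ → Inp p} {L n : ℕ}
    (h : pathCost G (σ, 0) u L = 0) (hn : n < L * s) : symbol G σ u n = 0 := by
  rw [pathCost_eq_sum_symbolCost, Finset.sum_eq_zero_iff] at h
  by_contra hne
  exact one_ne_zero ((if_pos hne).symm.trans (h n (Finset.mem_range.2 hn)))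

lemma IsEvent.pathCost_ne_zero (hG : LinearIndependent (ZMod 2)[X] G) {L : ℕ} {w : Msg p L}
    (hw : IsEvent G w) : pathCost G 0 (extend w) L ≠ 0 := by
  intro h0
  refine hw.2.1 (congrFun (eq_zero_of_outBit_eq_zero hG (fun t => extend_of_le w)
    fun t k => ?_) 0)
  obtain ht | ht := lt_or_ge t L
  · have hsymbol : symbol G 0 (extend w) (t * s + k) = 0 := by
      refine symbol_eq_zero_of_pathCost_eq_zero h0 ?_
      calc t * s + k < t * s + s := Nat.add_lt_add_left k.2 _
        _ = (t + 1) * s := (Nat.succ_mul t s).symm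
        _ ≤ L * s := Nat.mul_le_mul_right s ht
    rwa [symbol_block G 0 (extend w) t k.2, stepBits, Fin.ofNat_val_eq_self] at hsymbol
  · have hstate := diffStateAt_eq_zero_of_le hw.2.2.2 (fun _ => extend_of_le w) ht
    rw [show (0 : DiffState G) = (0, 0) from rfl, diffStateAt_eq_stateAt, Prod.mk.injEq] at hstate
    rw [hstate.1, extend_of_le w ht, outBit_zero]

section Channel

variable {Ω : Type*} [MeasurableSpace Ω] {P : Measure Ω} {N0 : ℝ} {Z : (ℝ → ℂ) → Ω → ℝ}

/-- The event that, with the segment `w` at time `a` exchanged, the transmitted block `u` becomes at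
least as likely. -/
def segmentError (G : Gen p s) (K : ℕ) (T Es : ℝ) (Z : (ℝ → ℂ) → Ω → ℝ) {N : ℕ} (u : Msg p N)
    (a : ℕ) {L : ℕ} (w : Msg p L) : Set Ω :=
  {ω | received G K T Es Z u ω u ≤ received G K T Es Z u ω (u - placedBlock N a w)}

lemma nullMeasurableSet_segmentError (hZ : IsWhiteNoise P N0 Z) (K : ℕ) (T Es : ℝ)
    {N : ℕ} (u : Msg p N) (a : ℕ) {L : ℕ} (w : Msg p L) :
    NullMeasurableSet (segmentError G K T Es Z u a w) P := by
  have hmeas (v : Msg p N) : AEMeasurable (Z (signal G K T Es v)) P :=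
    (hZ.memLp (memLp_signal G K T Es v)).aestronglyMeasurable.aemeasurable
  exact nullMeasurableSet_le ((hmeas _).const_add _) ((hmeas _).const_add _)

variable [IsProbabilityMeasure P]

lemma measureReal_segmentError (hZ : IsWhiteNoise P N0 Z) (hN0 : 0 < N0) {K : ℕ} (hK : Odd K)
    {T Es : ℝ} (hT : 0 < T) (hEs : 0 < Es) {N : ℕ} (u : Msg p N) {a L : ℕ} {w : Msg p L}
    (hw : IsSegment G N a w) (hcost : pathCost G 0 (extend w) L ≠ 0) :
    P.real (segmentError G K T Es Z u a w) = gaussQ √(pathCost G 0 (extend w) L * (Es / N0)) := by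
  have h := hw.pathCost_sub_placedBlock u
  rw [segmentError, measureReal_received_le hZ hN0 G hK hT hEs u _ (h.trans_ne hcost), h]

lemma measureReal_segmentError_le (hZ : IsWhiteNoise P N0 Z) (hN0 : 0 < N0) {K : ℕ} (hK : Odd K)
    {T Es : ℝ} (hT : 0 < T) (hEs : 0 < Es) {N : ℕ} (u : Msg p N) {a L : ℕ} {w : Msg p L}
    (hw : IsSegment G N a w) :
    P.real (segmentError G K T Es Z u a w) ≤
      Real.exp (-(Es / N0 / 2)) ^ pathCost G 0 (extend w) L := by
  obtain h0 | hcost := eq_or_ne (pathCost G 0 (extend w) L) 0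
  · rw [h0, pow_zero]
    exact measureReal_le_one
  · rw [measureReal_segmentError hZ hN0 hK hT hEs u hw hcost]
    exact gaussQ_sqrt_natCast_mul_le_pow (by positivity) _

lemma IsWhiteNoise.ae_forall_sub_eq (hZ : IsWhiteNoise P N0 Z) {ι : Type*} [Countable ι]
    {f : ι → ℝ → ℂ} (hf : ∀ i, MemLp (f i) 2) :
    ∀ᵐ ω ∂P, ∀ i j k l, f i - f j = f k - f l →
      Z (f i) ω - Z (f j) ω = Z (f k) ω - Z (f l) ω := by
  simp only [ae_all_iff]
  exact fun i j k l => hZ.sub_ae_eq (hf i) (hf j) (hf k) (hf l)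

/-- The transmitted block with the segment exchanged is preferred to the transmitted block by the
same amount as the decoded block is preferred to the decoded block with the segment exchanged. -/
lemma ae_mem_segmentError (hZ : IsWhiteNoise P N0 Z) (K : ℕ) {T : ℝ} (hT : 0 < T) (Es : ℝ) {N : ℕ}
    {dec : (Msg p N → ℝ) → Msg p N} (hdec : IsMLSD G K T Es dec) (u : Msg p N) :
    ∀ᵐ ω ∂P, ∀ (a L : ℕ) (w : Msg p L), IsSegment G N a w →
      OccursIn G (extend (u - dec (received G K T Es Z u ω))) (a, ⟨L, w⟩) →
      ω ∈ segmentError G K T Es Z u a w := by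
  have hs (v : Msg p N) := memLp_signal G K T Es v
  filter_upwards [hZ.ae_forall_sub_eq hs] with ω hω a L w hw hocc
  have hsignal := signal_exchange K hT Es hw hocc
  have hnoise := hω _ _ _ _ hsignal
  have hcorr := congrArg (corr (signal G K T Es u)) hsignal
  rw [corr_sub_right (hs u) (hs _) (hs _), corr_sub_right (hs u) (hs _) (hs u)] at hcorr
  have hmax := hdec.maximal (received G K T Es Z u ω)
    (dec (received G K T Es Z u ω) + placedBlock N a w)
  rw [corr_signal_self G K T Es _ (dec (received G K T Es Z u ω)),
    sub_le_sub_iff_right] at hmax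
  simp only [received] at hmax hnoise hcorr
  simp only [segmentError, received, Set.mem_ofPred_eq]
  linarith

lemma integral_bitErrors_le (hZ : IsWhiteNoise P N0 Z) (K : ℕ) {T : ℝ} (hT : 0 < T) (Es : ℝ)
    {N : ℕ} {dec : (Msg p N → ℝ) → Msg p N} (hdec : IsMLSD G K T Es dec) (u : Msg p N) :
    ∫ ω, (bitErrors u (dec (received G K T Es Z u ω)) : ℝ) ∂P ≤
      ∑ x ∈ segments G N, bitErrors x.2.2 0 * P.real (segmentError G K T Es Z u x.1 x.2.2) := by
  classical
  have hmeas (x : ℕ × Σ L, Msg p L) : NullMeasurableSet (segmentError G K T Es Z u x.1 x.2.2) P :=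
    nullMeasurableSet_segmentError hZ K T Es u x.1 x.2.2
  have hint (x : ℕ × Σ L, Msg p L) : Integrable ((segmentError G K T Es Z u x.1 x.2.2).indicator
      fun _ => (bitErrors x.2.2 0 : ℝ)) P := (integrable_const _).indicator₀ (hmeas x)
  calc ∫ ω, (bitErrors u (dec (received G K T Es Z u ω)) : ℝ) ∂P
      ≤ ∫ ω, ∑ x ∈ segments G N, (segmentError G K T Es Z u x.1 x.2.2).indicator
          (fun _ => (bitErrors x.2.2 0 : ℝ)) ω ∂P := by
        refine integral_mono_of_nonneg (ae_of_all _ fun ω => Nat.cast_nonneg _)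
          (integrable_finsetSum _ fun x _ => hint x) ?_
        filter_upwards [ae_mem_segmentError hZ K hT Es hdec u] with ω hω
        refine (Nat.cast_le.2 (bitErrors_le_sum_segments G u _)).trans ?_
        rw [Nat.cast_sum, Finset.sum_filter]
        refine Finset.sum_le_sum fun x hx => ?_
        split_ifs with hocc
        · rw [Set.indicator_of_mem (hω _ _ _ (isSegment_of_mem_segments hx) hocc)]
        · exact Set.indicator_nonneg (fun _ _ => Nat.cast_nonneg _) _
    _ = ∑ x ∈ segments G N, bitErrors x.2.2 0 * P.real (segmentError G K T Es Z u x.1 x.2.2) := by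
        rw [integral_finsetSum _ fun x _ => hint x]
        refine Finset.sum_congr rfl fun x _ => ?_
        rw [integral_indicator₀ (hmeas x), setIntegral_const, smul_eq_mul, mul_comm]

end Channel

end UnionBound

/-! ### The bit error probability -/

section BitErrorProbability

variable {p s : ℕ} [NeZero s] {G : Gen p s}

open Classical in
lemma sum_segments_isEvent_le (N : ℕ) {f : (Σ L, Msg p L) → ℝ} (hf : ∀ w, 0 ≤ f w)
    (h : Summable fun e : EventWord G => f ⟨e.1, e.2.1⟩) :
    ∑ x ∈ segments G N with IsEvent G x.2.2, f x.2 ≤ N * ∑' e : EventWord G, f ⟨e.1, e.2.1⟩ := by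
  set S : Finset (Σ L, Msg p L) := (Finset.range (N + 1)).sigma fun _ => Finset.univ
  have hsub : {x ∈ segments G N | IsEvent G x.2.2} ⊆
      Finset.range N ×ˢ {w ∈ S | IsEvent G w.2} := fun x hx => by
    simp only [segments, Finset.mem_filter, Finset.mem_product] at hx ⊢
    exact ⟨hx.1.1.1, hx.1.1.2, hx.2⟩
  calc ∑ x ∈ segments G N with IsEvent G x.2.2, f x.2
      ≤ ∑ x ∈ Finset.range N ×ˢ {w ∈ S | IsEvent G w.2}, f x.2 :=
        Finset.sum_le_sum_of_subset_of_nonneg hsub fun _ _ _ => hf _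
    _ = N * ∑ w ∈ S with IsEvent G w.2, f w := by
        simp only [Finset.sum_product, Finset.sum_const, Finset.card_range, nsmul_eq_mul]
    _ = N * ∑ e ∈ (Finset.range (N + 1)).sigma fun L =>
          (Finset.univ : Finset {w : Msg p L // IsEvent G w}), f ⟨e.1, e.2.1⟩ := by
        rw [Finset.sum_filter, Finset.sum_sigma, Finset.sum_sigma]
        exact congrArg _ (Finset.sum_congr rfl fun L _ =>
          (sum_msg_ite_isEvent fun w => f ⟨L, w⟩).symm)
    _ ≤ N * ∑' e : EventWord G, f ⟨e.1, e.2.1⟩ :=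
        mul_le_mul_of_nonneg_left (h.sum_le_tsum _ fun _ _ => hf _) (Nat.cast_nonneg _)

lemma IsSegment.eq_and_avoids {N a L : ℕ} {w : Msg p L} (h : IsSegment G N a w)
    (hw : ¬ IsEvent G w) : a + L = N ∧ Avoids G 0 (extend w) (L + 1) :=
  h.resolve_left fun h => hw h.2

open Classical in
lemma sum_segments_not_isEvent_le (N : ℕ) {f : (Σ L, Msg p L) → ℝ} (hf : ∀ w, 0 ≤ f w) :
    ∑ x ∈ segments G N with ¬ IsEvent G x.2.2, f x.2 ≤
      ∑ L ∈ Finset.range (N + 1), ∑ w : Msg p L,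
        if Avoids G 0 (extend w) (L + 1) then f ⟨L, w⟩ else 0 := by
  have htail (x : ℕ × Σ L, Msg p L) (hx : x ∈ {x ∈ segments G N | ¬ IsEvent G x.2.2}) :
      x.1 + x.2.1 = N ∧ Avoids G 0 (extend x.2.2) (x.2.1 + 1) :=
    have hx := Finset.mem_filter.1 hx
    (isSegment_of_mem_segments hx.1).eq_and_avoids hx.2
  have hinj : Set.InjOn Prod.snd (SetLike.coe {x ∈ segments G N | ¬ IsEvent G x.2.2}) :=
    fun x hx y hy hxy => Prod.ext (Nat.add_right_cancel ((htail x hx).1.trans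
      (hxy ▸ (htail y hy).1.symm))) hxy
  calc ∑ x ∈ segments G N with ¬ IsEvent G x.2.2, f x.2
      = ∑ w ∈ Finset.image Prod.snd {x ∈ segments G N | ¬ IsEvent G x.2.2}, f w :=
        (Finset.sum_image hinj).symm
    _ ≤ ∑ w ∈ (Finset.range (N + 1)).sigma fun _ => Finset.univ with
          Avoids G 0 (extend w.2) (w.1 + 1), f w := by
        refine Finset.sum_le_sum_of_subset_of_nonneg (fun w hw => ?_) fun _ _ _ => hf _
        obtain ⟨x, hx, rfl⟩ := Finset.mem_image.1 hw
        have hseg := (Finset.mem_filter.1 (Finset.mem_filter.1 hx).1).1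
        exact Finset.mem_filter.2 ⟨(Finset.mem_product.1 hseg).2, (htail x hx).2⟩
    _ = ∑ L ∈ Finset.range (N + 1), ∑ w : Msg p L,
          if Avoids G 0 (extend w) (L + 1) then f ⟨L, w⟩ else 0 := by
        rw [Finset.sum_filter, Finset.sum_sigma]

lemma summable_errors_mul_gaussQ {c : ℝ} (hc : 0 ≤ c)
    (h : Summable fun e : EventWord G => Real.exp (-(c / 2)) ^ e.cost) :
    Summable fun e : EventWord G => e.errors * gaussQ √(e.cost * c) :=
  Summable.of_nonneg_of_le (fun _ => mul_nonneg (Nat.cast_nonneg _) (gaussQ_pos _).le)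
    (fun _ => mul_le_mul_of_nonneg_left (gaussQ_sqrt_natCast_mul_le_pow hc _) (Nat.cast_nonneg _))
    (summable_errors_mul (Real.exp_pos _) h)

open Classical in
/-- The unterminated segments contribute only a bounded amount, since the weight of the paths that
avoid the zero state decays geometrically. -/
lemma exists_sum_avoids_le {ζ : ℝ} (hζ : 0 < ζ)
    (h : Summable fun e : EventWord G => ζ ^ e.cost) :
    ∃ B : ℝ, ∀ N, ∑ L ∈ Finset.range N, ∑ w : Msg p L,
      (if Avoids G 0 (extend w) (L + 1) then bitErrors w 0 * ζ ^ pathCost G 0 (extend w) L else 0) ≤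
        B := by
  obtain ⟨ρ, C, hρ0, hρ1, hC, hdecay⟩ := exists_sum_weight_le_real hζ h
  have hgeom : Summable fun L : ℕ => (p * L : ℝ) * (C * ρ ^ L) := by
    refine ((summable_pow_mul_geometric_of_norm_lt_one 1
      (by rwa [Real.norm_of_nonneg hρ0])).mul_left (p * C)).congr fun L => ?_
    ring
  refine ⟨∑' L : ℕ, (p * L : ℝ) * (C * ρ ^ L), fun N => (Finset.sum_le_sum fun L _ => ?_).trans
    (hgeom.sum_le_tsum (Finset.range N) fun L _ => by positivity)⟩
  calc ∑ w : Msg p L,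
        (if Avoids G 0 (extend w) (L + 1) then bitErrors w 0 * ζ ^ pathCost G 0 (extend w) L else 0)
      ≤ ∑ w : Msg p L, (p * L : ℝ) *
        if Avoids G 0 (extend w) (L + 1) then ζ ^ pathCost G 0 (extend w) L else 0 := by
        refine Finset.sum_le_sum fun w _ => ?_
        split_ifs
        · exact mul_le_mul_of_nonneg_right (by exact_mod_cast bitErrors_le w 0) (by positivity)
        · rw [mul_zero]
    _ ≤ (p * L : ℝ) * (C * ρ ^ L) := by
        rw [← Finset.mul_sum]
        exact mul_le_mul_of_nonneg_left (hdecay L).1 (by positivity)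

theorem exists_integral_bitErrors_le {Ω : Type*} [MeasurableSpace Ω] {P : Measure Ω}
    [IsProbabilityMeasure P] {N0 : ℝ} {Z : (ℝ → ℂ) → Ω → ℝ} (hZ : IsWhiteNoise P N0 Z)
    (hN0 : 0 < N0) (hG : LinearIndependent (ZMod 2)[X] G) {K : ℕ} (hK : Odd K) {T Es : ℝ}
    (hT : 0 < T) (hEs : 0 < Es)
    (h : Summable fun e : EventWord G => Real.exp (-(Es / N0 / 2)) ^ e.cost) :
    ∃ B : ℝ, ∀ (N : ℕ) (dec : (Msg p N → ℝ) → Msg p N), IsMLSD G K T Es dec → ∀ u : Msg p N,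
      ∫ ω, (bitErrors u (dec (received G K T Es Z u ω)) : ℝ) ∂P ≤
        N * (∑' e : EventWord G, e.errors * gaussQ √(e.cost * (Es / N0))) + B := by
  classical
  obtain ⟨B, hB⟩ := exists_sum_avoids_le (Real.exp_pos _) h
  refine ⟨B, fun N dec hdec u => (integral_bitErrors_le hZ K hT Es hdec u).trans ?_⟩
  rw [← Finset.sum_filter_add_sum_filter_not _ fun x => IsEvent G x.2.2]
  refine add_le_add ?_ ?_
  · refine le_trans (Finset.sum_le_sum fun x hx => ?_) (sum_segments_isEvent_le N
      (f := fun w => bitErrors w.2 0 * gaussQ √(pathCost G 0 (extend w.2) w.1 * (Es / N0)))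
      (fun _ => mul_nonneg (Nat.cast_nonneg _) (gaussQ_pos _).le)
      (summable_errors_mul_gaussQ (by positivity) h))
    obtain ⟨hmem, hx⟩ := Finset.mem_filter.1 hx
    rw [measureReal_segmentError hZ hN0 hK hT hEs u (isSegment_of_mem_segments hmem)
      (hx.pathCost_ne_zero hG)]
  · refine le_trans (Finset.sum_le_sum fun x hx => ?_) ((sum_segments_not_isEvent_le N
      (f := fun w => bitErrors w.2 0 * Real.exp (-(Es / N0 / 2)) ^ pathCost G 0 (extend w.2) w.1)
      fun _ => by positivity).trans (hB (N + 1)))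
    exact mul_le_mul_of_nonneg_left (measureReal_segmentError_le hZ hN0 hK hT hEs u
      (isSegment_of_mem_segments (Finset.mem_filter.1 hx).1)) (Nat.cast_nonneg _)

section

variable {Ω : Type*} [MeasurableSpace Ω] (P : Measure Ω) (G : Gen p s) (K : ℕ) (T Es : ℝ)
  (Z : (ℝ → ℂ) → Ω → ℝ)

lemma blockBER_nonneg {N : ℕ} (dec : (Msg p N → ℝ) → Msg p N) :
    0 ≤ blockBER P G K T Es Z dec :=
  mul_nonneg (by positivity) (Finset.sum_nonneg fun _ _ => integral_nonneg fun _ => by positivity)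

variable {P G K T Es Z}

lemma blockBER_le {N : ℕ} {dec : (Msg p N → ℝ) → Msg p N} {M : ℝ}
    (h : ∀ u, ∫ ω, (bitErrors u (dec (received G K T Es Z u ω)) : ℝ) ∂P ≤ M) :
    blockBER P G K T Es Z dec ≤ M / (p * N) := by
  rw [blockBER, inv_mul_le_iff₀ (by positivity)]
  refine (Finset.sum_le_card_nsmul _ _ (M / (p * N)) fun u _ => ?_).trans_eq ?_
  · rw [integral_div]
    exact div_le_div_of_nonneg_right (h u) (by positivity)
  · rw [Finset.card_univ, card_msg, nsmul_eq_mul, Nat.cast_pow, Nat.cast_ofNat]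

theorem bitErrorProb_le {dec : (N : ℕ) → (Msg p N → ℝ) → Msg p N} {A B : ℝ}
    (h : ∀ (N : ℕ) (u : Msg p N),
      ∫ ω, (bitErrors u (dec N (received G K T Es Z u ω)) : ℝ) ∂P ≤ N * A + B) :
    bitErrorProb P G K T Es Z dec ≤ 1 / p * A := by
  have hle : ∀ᶠ N : ℕ in atTop,
      blockBER P G K T Es Z (dec N) ≤ 1 / p * A + B / p * (N : ℝ)⁻¹ := by
    filter_upwards [eventually_ne_atTop 0] with N hN
    refine (blockBER_le (h N)).trans_eq ?_
    rw [add_div, mul_comm (p : ℝ), mul_div_mul_left _ _ (Nat.cast_ne_zero.2 hN)]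
    ring
  have hlim : Tendsto (fun N : ℕ => 1 / p * A + B / p * (N : ℝ)⁻¹) atTop (nhds (1 / p * A)) := by
    simpa only [mul_zero, add_zero] using
      ((tendsto_inv_atTop_nhds_zero_nat (𝕜 := ℝ)).const_mul (B / p)).const_add (1 / p * A)
  rw [bitErrorProb, ← hlim.limsup_eq]
  exact limsup_le_limsup hle (isBoundedUnder_of ⟨0, fun N =>
    blockBER_nonneg P G K T Es Z (dec N)⟩).isCoboundedUnder_le hlim.isBoundedUnder_le

end

/-! ### Comparison with the minimum distance -/

lemma dminSq_nonneg (G : Gen p s) {K : ℕ} (hK : Odd K) {T : ℝ} (hT : 0 < T) :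
    0 ≤ dminSq G K T :=
  Real.sInf_nonneg <| Set.forall_mem_range.2 fun E =>
    (Nat.cast_nonneg _).trans_eq (E.nsed_eq_cost_eventWord hK hT).symm

lemma dminSq_le_cost {K : ℕ} (hK : Odd K) {T : ℝ} (hT : 0 < T) (e : EventWord G) :
    dminSq G K T ≤ e.cost := by
  have hnsed (E : ErrorEvent G) : E.nsed K T = E.eventWord.cost := E.nsed_eq_cost_eventWord hK hT
  refine csInf_le ⟨0, Set.forall_mem_range.2 fun E => ?_⟩ ⟨e.errorEvent 0 0, ?_⟩
  · exact (Nat.cast_nonneg _).trans_eq (hnsed E).symm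
  · exact (hnsed _).trans (by rw [e.eventWord_errorEvent])

lemma diffStateAt_succ_ne_zero {i : Fin p} (hi : 0 < mem G i) {u : ℕ → Inp p} {t : ℕ}
    (ht : u t i ≠ 0) : diffStateAt G 0 u (t + 1) ≠ 0 := by
  intro h
  rw [diffStateAt, diffStep, Prod.mk_eq_zero] at h
  exact ht ((if_pos rfl).symm.trans (congrFun (congrFun h.1 i) ⟨0, hi⟩))

/-- Feeding ones for `n` steps keeps a shift register nonzero; from there some input leads back to
the zero state. -/
lemma exists_eventWord_len_gt (hm : 0 < memory G) (n : ℕ) : ∃ e : EventWord G, n < e.1 := by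
  classical
  obtain ⟨i, -, hi⟩ := Finset.sum_pos_iff.1 hm
  obtain ⟨v, t, hv⟩ := Reachable.exists_diffStateAt_eq_zero (G := G) ⟨fun _ => 1, n + 1, rfl⟩
  let u : ℕ → Inp p := fun k => if k < n + 1 then 1 else v (k - (n + 1))
  have hone {k : ℕ} (hk : k < n + 1) : u k = 1 := if_pos hk
  have hu (k : ℕ) (hk : k < n + 1) : diffStateAt G 0 u (k + 1) ≠ 0 :=
    diffStateAt_succ_ne_zero hi (by rw [hone hk]; exact one_ne_zero)
  have hzero : diffStateAt G 0 u (n + 1 + t) = 0 := by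
    rw [diffStateAt_add, diffStateAt_congr G 0 (v := fun _ => 1) fun k hk => hone hk,
      diffStateAt_congr G _ (v := v) fun k _ => ?_, hv]
    exact (if_neg (by omega)).trans (by rw [Nat.add_sub_cancel_left])
  have hex : ∃ b, 0 < b ∧ diffStateAt G 0 u b = 0 := ⟨n + 1 + t, by omega, hzero⟩
  obtain ⟨hb0, hb⟩ := Nat.find_spec hex
  have hmin {k : ℕ} (hk : k < Nat.find hex) : ¬ (0 < k ∧ diffStateAt G 0 u k = 0) :=
    Nat.find_min hex hk
  generalize Nat.find hex = b at hb0 hb hmin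
  refine ⟨⟨b, window u 0 b, isEvent_window hb0 rfl ?_ hb fun k h0 hk h => hmin hk ⟨h0, h⟩⟩, ?_⟩
  · rw [hone n.succ_pos]
    exact fun h => one_ne_zero (congrFun h i)
  · by_contra! hle
    obtain ⟨k, rfl⟩ := Nat.exists_eq_succ_of_ne_zero hb0.ne'
    exact hu k (Nat.lt_succ_of_lt hle) hb

lemma infinite_eventWord (hm : 0 < memory G) : Infinite (EventWord G) := by
  have hlen : (Set.range fun e : EventWord G => e.1).Infinite :=
    Set.infinite_of_forall_exists_gt fun n =>
      let ⟨e, he⟩ := exists_eventWord_len_gt hm n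
      ⟨e.1, ⟨e, rfl⟩, he⟩
  exact not_finite_iff_infinite.1 fun _ => hlen (Set.finite_range _)

lemma exists_lt_cost (hm : 0 < memory G) {c : ℝ} (hc : 0 < c)
    (h : Summable fun e : EventWord G => Real.exp (-(c / 2)) ^ e.cost) (D : ℝ) :
    ∃ e : EventWord G, D < e.cost := by
  have := infinite_eventWord hm
  obtain ⟨e, he⟩ := (h.tendsto_cofinite_zero.eventually_lt_const
    (Real.exp_pos (-(D * c / 2)))).exists
  rw [exp_neg_half_pow, Real.exp_lt_exp, neg_lt_neg_iff] at he
  exact ⟨e, by nlinarith⟩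

lemma EventWord.errors_pos (e : EventWord G) : 0 < e.errors := by
  obtain ⟨j, hj⟩ := Function.ne_iff.1 e.2.2.2.1
  rw [extend_of_lt _ e.2.2.1] at hj
  exact Finset.card_pos.2 ⟨(⟨0, e.2.2.1⟩, j), by simpa using hj⟩

theorem tsum_gaussQ_lt (hm : 0 < memory G) {K : ℕ} (hK : Odd K) {T c : ℝ} (hT : 0 < T)
    (hc : 0 < c) (h : Summable fun e : EventWord G => Real.exp (-(c / 2)) ^ e.cost) :
    ∑' e : EventWord G, e.errors * gaussQ √(e.cost * c) <
      gaussQ √(dminSq G K T * c) * Real.exp (dminSq G K T * (c / 2)) *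
        ∑' e : EventWord G, e.errors * Real.exp (-(c / 2)) ^ e.cost := by
  have hd : 0 ≤ dminSq G K T * c := mul_nonneg (dminSq_nonneg G hK hT) hc.le
  obtain ⟨e₀, he₀⟩ := exists_lt_cost hm hc h (dminSq G K T)
  rw [← mul_div_assoc, ← tsum_mul_left]
  refine Summable.tsum_lt_tsum (i := e₀) (fun e => ?_) ?_ (summable_errors_mul_gaussQ hc.le h)
    ((summable_errors_mul (Real.exp_pos _) h).mul_left _)
  · simp only [mul_left_comm _ (e.errors : ℝ), exp_neg_half_pow]
    exact mul_le_mul_of_nonneg_left (gaussQ_sqrt_le_mul_exp hd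
      (mul_le_mul_of_nonneg_right (dminSq_le_cost hK hT e) hc.le)) (Nat.cast_nonneg _)
  · rw [mul_left_comm, exp_neg_half_pow]
    exact mul_lt_mul_of_pos_left (gaussQ_sqrt_lt_mul_exp hd (mul_lt_mul_of_pos_right he₀ hc))
      (Nat.cast_pos.2 e₀.errors_pos)

end BitErrorProbability

end DistCPFSK

end

theorem theorem1 {p s : ℕ} [NeZero s] (G : DistCPFSK.Gen p s)
    (hG : LinearIndependent (Polynomial (ZMod 2)) G) (hm : 0 < DistCPFSK.memory G)
    (K : ℕ) (hK : Odd K) (T Eb N0 r Es ζ : ℝ) (hT : 0 < T) (hEb : 0 < Eb) (hN0 : 0 < N0)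
    (hr : r = (p : ℝ) / s) (hEs : Es = r * Eb) (hζ : ζ = Real.exp (-(Eb * r / (2 * N0))))
    {Ω : Type*} [MeasurableSpace Ω] (P : MeasureTheory.Measure Ω)
    [MeasureTheory.IsProbabilityMeasure P]
    (Z : (ℝ → ℂ) → Ω → ℝ) (hZ : DistCPFSK.IsWhiteNoise P N0 Z)
    (dec : (N : ℕ) → (DistCPFSK.Msg p N → ℝ) → DistCPFSK.Msg p N)
    (hdec : ∀ N, DistCPFSK.IsMLSD G K T Es (dec N))
    (hF : ∀ (j : Fin p) (σ : DistCPFSK.JState G),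
      Summable (DistCPFSK.transferTerm G K T j σ (1 / 2) 1 ζ)) :
    DifferentiableAt ℝ (fun ε => DistCPFSK.transferFunction G K T (1 / 2) ε ζ) 1 ∧
    DistCPFSK.bitErrorProb P G K T Es Z dec <
      DistCPFSK.gaussQ (√(DistCPFSK.dminSq G K T * (Eb * r / N0))) *
        Real.exp (DistCPFSK.dminSq G K T * (Eb * r / (2 * N0))) *
        deriv (fun ε => DistCPFSK.transferFunction G K T (1 / 2) ε ζ) 1 := by
  have hp : 0 < p := Nat.pos_of_ne_zero fun h => hm.ne' (by subst h; simp [DistCPFSK.memory])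
  have hp' : (0 : ℝ) < p := Nat.cast_pos.2 hp
  have hs : (0 : ℝ) < s := Nat.cast_pos.2 (NeZero.pos s)
  have hEs0 : 0 < Es := by rw [hEs, hr]; positivity
  have hc : Eb * r / N0 = Es / N0 := by rw [hEs, mul_comm]
  have hc' : Eb * r / (2 * N0) = Es / N0 / 2 := by rw [← hc, div_div, mul_comm N0]
  rw [hc'] at hζ
  have hζ0 : 0 < ζ := hζ ▸ Real.exp_pos _
  have hsum := DistCPFSK.summable_pow_cost hp hK hT hζ0.le hF
  have hderiv := DistCPFSK.hasDerivAt_transferFunction hp hK hT hζ0 hsum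
  refine ⟨hderiv.differentiableAt, ?_⟩
  rw [hζ] at hsum
  obtain ⟨B, hB⟩ := DistCPFSK.exists_integral_bitErrors_le hZ hN0 hG hK hT hEs0 hsum
  refine (DistCPFSK.bitErrorProb_le fun N u => hB N (dec N) (hdec N) u).trans_lt ?_
  rw [hderiv.deriv, hc, hc', mul_left_comm, hζ]
  exact mul_lt_mul_of_pos_left (DistCPFSK.tsum_gaussQ_lt hm hK hT (div_pos hEs0 hN0) hsum)
    (one_div_pos.2 hp')
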